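/- Let $p$ and $q$ be prime numbers with $p \mid q-1$, and let $r \in \mathbb{Z}_q^{\times}$ be an element of order $p$. Let $$G=(\mathbb{Z}_q\times\mathbb{Z}_q)\rtimes(\mathbb{Z}_p\times\mathbb{Z}_p)=\langle \sigma,\tau,a,b : \sigma^p=\tau^p=1,\ a^q=b^q=1,\ \sigma a\sigma^{-1}=a^r,\ \tau b\tau^{-1}=b^r,\ [\sigma,b]=[\tau,a]=[a,b]=[\sigma,\tau]=1\rangle,$$ so that $G$ is the direct product of $\langle\sigma,a\rangle\simeq\mathbb{Z}_q\rtimes\mathbb{Z}_p$ and $\langle\tau,b\rangle\simeq\mathbb{Z}_q\rtimes\mathbb{Z}_p$. Let $K$ be a number field containing a primitive $p$-th root of unity $\zeta$, and put $$J=\frac1p\sum_{u,v=0}^{p-1}\zeta^{-uv}\,\tau^u\otimes\sigma^v\in KG\otimes_K KG .$$ The element $J$ is a twist for the group Hopf algebra $KG$ with comultiplication $\Delta$, counit $\varepsilon$ and antipode $S$; that is, $J$ is invertible, $(1\otimes J)(\mathrm{id}\otimes\Delta)(J)=(J\otimes 1)(\Delta\otimes \mathrm{id})(J)$ and $(\varepsilon\otimes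 \mathrm{id})(J)=(\mathrm{id}\otimes\varepsilon)(J)=1$. Let $B_{p,q}(\zeta)=(KG)_J$ be the Drinfel'd twist: the Hopf algebra that equals $KG$ as an algebra, has the same counit, and has comultiplication $\Delta_J(h)=J\Delta(h)J^{-1}$ and antipode $S_J(h)=U_J S(h)U_J^{-1}$, where $U_J=\sum J^{(1)}S(J^{(2)})$. A Hopf order of a finite-dimensional Hopf algebra $H$ over $K$, over a subring $R$ of $K$, is a finitely generated projective $R$-submodule $X$ of $H$ such that the natural map $X\otimes_R K\to H$ is an isomorphism, $1_H\in X$, $XX\subseteq X$, $\Delta_H(X)\subseteq X\otimes_R X$ (identified with its image in $H\otimes_K H$), $\varepsilon_H(X)\subseteq R$ and $S_H(X)\subseteq X$. **Theorem.** (1) Let $R\subseteq K$ be a Dedekind domain with $\mathcal{O}_K\subseteq R$. If $B_{p,q}(\zeta)$ admits a Hopf order over $R$, then $\frac1p\in R$. (2) Consequently, $B_{p,q}(\zeta)$ does not admit a Hopf order over any number ring: for every subfield $F\subseteq K$, there is no Hopf order of $B_{p,q}(\zeta)$ over the ring of integers $\mathcal{O}_F$. -/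

import Mathlib

open scoped TensorProduct

/-- A (Drinfel'd) twist for a Hopf algebra `H` over `K`: an invertible element `J` of `H ⊗ H`
with the 2-pseudo-cocycle property and the counital property. -/
structure HopfTwist (K H : Type*) [CommRing K] [Ring H] [HopfAlgebra K H] where
  /-- The invertible element of `H ⊗ H`. -/
  J : (H ⊗[K] H)ˣ
  /-- `(1 ⊗ J) (id ⊗ Δ)(J) = (J ⊗ 1) (Δ ⊗ id)(J)` in `H ⊗ H ⊗ H`. -/
  cocycle :
    (1 ⊗ₜ[K] (J : H ⊗[K] H)) *
        Algebra.TensorProduct.map (AlgHom.id K H) (Bialgebra.comulAlgHom K H) (J : H ⊗[K] H) =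
      Algebra.TensorProduct.assoc K K K H H H
        (((J : H ⊗[K] H) ⊗ₜ[K] 1) *
          Algebra.TensorProduct.map (Bialgebra.comulAlgHom K H) (AlgHom.id K H) (J : H ⊗[K] H))
  /-- `(ε ⊗ id)(J) = 1`. -/
  counit_left :
    Algebra.TensorProduct.lid K H
      (Algebra.TensorProduct.map (Bialgebra.counitAlgHom K H) (AlgHom.id K H)
        (J : H ⊗[K] H)) = 1
  /-- `(id ⊗ ε)(J) = 1`. -/
  counit_right :
    Algebra.TensorProduct.rid K K H
      (Algebra.TensorProduct.map (AlgHom.id K H) (Bialgebra.counitAlgHom K H)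
        (J : H ⊗[K] H)) = 1

/-- The inner automorphism `x ↦ u x u⁻¹` of an algebra. -/
def conjAlgHom (K : Type*) {A : Type*} [CommRing K] [Ring A] [Algebra K A] (u : Aˣ) :
    A →ₐ[K] A :=
  AlgHom.ofLinearMap
    (LinearMap.mulLeft K (u : A) ∘ₗ LinearMap.mulRight K ((u⁻¹ : Aˣ) : A))
    (by simp) (by intro x y; simp [mul_assoc])

theorem conjAlgHom_apply (K : Type*) {A : Type*} [CommRing K] [Ring A] [Algebra K A] (u : Aˣ)
    (x : A) : conjAlgHom K u x = u * x * ((u⁻¹ : Aˣ) : A) := by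
  simp [conjAlgHom, mul_assoc]

namespace HopfTwist

section

variable {K H : Type*} [CommRing K] [Ring H] [HopfAlgebra K H] (T : HopfTwist K H)

/-- The linear map `x ⊗ y ↦ S(x) t y`. -/
noncomputable def sandwichLeft (t : H) : H ⊗[K] H →ₗ[K] H :=
  LinearMap.mul' K H ∘ₗ
    (LinearMap.mulRight K t ∘ₗ HopfAlgebra.antipode K (A := H)).rTensor H

/-- The linear map `x ⊗ y ↦ x t S(y)`. -/
noncomputable def sandwichRight (t : H) : H ⊗[K] H →ₗ[K] H :=
  LinearMap.mul' K H ∘ₗ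
    (LinearMap.mulLeft K t ∘ₗ HopfAlgebra.antipode K (A := H)).lTensor H

theorem sandwichLeft_tmul (t x y : H) :
    sandwichLeft (K := K) t (x ⊗ₜ y) = HopfAlgebra.antipode K x * t * y := by
  simp [sandwichLeft]

theorem sandwichRight_tmul (t x y : H) :
    sandwichRight (K := K) t (x ⊗ₜ y) = x * (t * HopfAlgebra.antipode K y) := by
  simp [sandwichRight]

theorem sandwichLeft_mul (t : H) (a b : H ⊗[K] H) :
    sandwichLeft (K := K) t (a * b) = sandwichLeft (K := K) (sandwichLeft (K := K) t a) b := by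
  induction b using TensorProduct.induction_on with
  | zero => simp
  | add x y hx hy => rw [mul_add, map_add, map_add, hx, hy]
  | tmul z w =>
    induction a using TensorProduct.induction_on with
    | zero => simp [sandwichLeft_tmul]
    | add x y hx hy =>
      rw [add_mul, map_add, map_add, hx, hy]
      simp only [sandwichLeft_tmul, mul_add, add_mul]
    | tmul x y =>
      simp only [Algebra.TensorProduct.tmul_mul_tmul, sandwichLeft_tmul,
        HopfAlgebra.antipode_mul_antidistrib, mul_assoc]

theorem sandwichRight_mul (t : H) (a b : H ⊗[K] H) :
    sandwichRight (K := K) t (a * b) =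
      sandwichRight (K := K) (sandwichRight (K := K) t b) a := by
  induction a using TensorProduct.induction_on with
  | zero => simp
  | add x y hx hy => rw [add_mul, map_add, map_add, hx, hy]
  | tmul z w =>
    induction b using TensorProduct.induction_on with
    | zero => simp [sandwichRight_tmul]
    | add x y hx hy =>
      rw [mul_add, map_add, map_add, hx, hy]
      simp only [sandwichRight_tmul, mul_add, add_mul]
    | tmul x y =>
      simp only [Algebra.TensorProduct.tmul_mul_tmul, sandwichRight_tmul,
        HopfAlgebra.antipode_mul_antidistrib, mul_assoc]

theorem sandwichLeft_smul_one (r : K) (b : H ⊗[K] H) :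
    sandwichLeft (K := K) (r • (1 : H)) b = r • sandwichLeft (K := K) (1 : H) b := by
  induction b using TensorProduct.induction_on with
  | zero => simp
  | add x y hx hy => simp only [map_add, hx, hy, smul_add]
  | tmul x y => simp [sandwichLeft_tmul]

theorem sandwichRight_smul_one (r : K) (b : H ⊗[K] H) :
    sandwichRight (K := K) (r • (1 : H)) b = r • sandwichRight (K := K) (1 : H) b := by
  induction b using TensorProduct.induction_on with
  | zero => simp
  | add x y hx hy => simp only [map_add, hx, hy, smul_add]
  | tmul x y => simp [sandwichRight_tmul]

theorem sandwichLeft_one_comul (h : H) :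
    sandwichLeft (K := K) (1 : H) (Coalgebra.comul (R := K) h) =
      Coalgebra.counit (R := K) h • (1 : H) := by
  rw [← Algebra.algebraMap_eq_smul_one, ← HopfAlgebra.mul_antipode_rTensor_comul_apply]
  simp [sandwichLeft]

theorem sandwichRight_one_comul (h : H) :
    sandwichRight (K := K) (1 : H) (Coalgebra.comul (R := K) h) =
      Coalgebra.counit (R := K) h • (1 : H) := by
  rw [← Algebra.algebraMap_eq_smul_one, ← HopfAlgebra.mul_antipode_lTensor_comul_apply]
  simp [sandwichRight]

theorem sandwichLeft_one (t : H) : sandwichLeft (K := K) t (1 : H ⊗[K] H) = t := by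
  simp [Algebra.TensorProduct.one_def, sandwichLeft_tmul]

theorem sandwichRight_one (t : H) : sandwichRight (K := K) t (1 : H ⊗[K] H) = t := by
  simp [Algebra.TensorProduct.one_def, sandwichRight_tmul]

/-- `U_J = ∑ J⁽¹⁾ S(J⁽²⁾)`. -/
noncomputable def U : H :=
  LinearMap.mul' K H ((HopfAlgebra.antipode K (A := H)).lTensor H (T.J : H ⊗[K] H))

/-- `U_J⁻¹ = ∑ S(J⁻⁽¹⁾) J⁻⁽²⁾`. -/
noncomputable def Uinv : H :=
  LinearMap.mul' K H
    ((HopfAlgebra.antipode K (A := H)).rTensor H ((T.J⁻¹ : (H ⊗[K] H)ˣ) : H ⊗[K] H))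

theorem U_eq : T.U = sandwichRight (K := K) 1 (T.J : H ⊗[K] H) := by
  simp [U, sandwichRight]

theorem Uinv_eq :
    T.Uinv = sandwichLeft (K := K) 1 ((T.J⁻¹ : (H ⊗[K] H)ˣ) : H ⊗[K] H) := by
  simp [Uinv, sandwichLeft]

/-- The linear map `x ⊗ (y ⊗ z) ↦ x S(y) z`. -/
noncomputable def tripleMap (K H : Type*) [CommRing K] [Ring H] [HopfAlgebra K H] :
    H ⊗[K] (H ⊗[K] H) →ₗ[K] H :=
  LinearMap.mul' K H ∘ₗ (sandwichLeft (K := K) (1 : H)).lTensor H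

theorem tripleMap_tmul (x : H) (t : H ⊗[K] H) :
    tripleMap K H (x ⊗ₜ t) = x * sandwichLeft (K := K) 1 t := by
  simp [tripleMap]

theorem tripleMap_tmul_mul_assoc (x w : H) (s d : H ⊗[K] H) :
    tripleMap K H ((x ⊗ₜ s) * Algebra.TensorProduct.assoc K K K H H H (d ⊗ₜ w)) =
      x * sandwichRight (K := K) 1 d * sandwichLeft (K := K) 1 s * w := by
  induction d using TensorProduct.induction_on with
  | zero => simp
  | add d e hd he => simp only [TensorProduct.add_tmul, map_add, mul_add, add_mul, hd, he]
  | tmul d e =>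
    rw [Algebra.TensorProduct.assoc_tmul, Algebra.TensorProduct.tmul_mul_tmul, tripleMap_tmul,
      sandwichRight_tmul]
    induction s using TensorProduct.induction_on with
    | zero => simp
    | add s t hs ht => simp only [map_add, mul_add, add_mul, hs, ht]
    | tmul s t =>
      simp only [Algebra.TensorProduct.tmul_mul_tmul, sandwichLeft_tmul,
        HopfAlgebra.antipode_mul_antidistrib, mul_assoc, one_mul]

theorem tripleMap_map_mul_map (a b : H ⊗[K] H) :
    tripleMap K H
        (Algebra.TensorProduct.map (AlgHom.id K H) (Bialgebra.comulAlgHom K H) a *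
          Algebra.TensorProduct.assoc K K K H H H
            (Algebra.TensorProduct.map (Bialgebra.comulAlgHom K H) (AlgHom.id K H) b)) =
      Algebra.TensorProduct.rid K K H
          (Algebra.TensorProduct.map (AlgHom.id K H) (Bialgebra.counitAlgHom K H) a) *
        Algebra.TensorProduct.lid K H
          (Algebra.TensorProduct.map (Bialgebra.counitAlgHom K H) (AlgHom.id K H) b) := by
  induction a using TensorProduct.induction_on with
  | zero => simp
  | add x y hx hy => simp only [map_add, add_mul, hx, hy]
  | tmul x y =>
    induction b using TensorProduct.induction_on with
    | zero => simp
    | add z w hz hw => simp only [map_add, mul_add, hz, hw]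
    | tmul z w =>
      simp only [Algebra.TensorProduct.map_tmul, AlgHom.coe_id, id_eq,
        Bialgebra.comulAlgHom_apply, Bialgebra.counitAlgHom_apply]
      rw [tripleMap_tmul_mul_assoc, sandwichLeft_one_comul, sandwichRight_one_comul]
      simp [smul_smul, mul_comm]

theorem counit_left_inv :
    Algebra.TensorProduct.lid K H
      (Algebra.TensorProduct.map (Bialgebra.counitAlgHom K H) (AlgHom.id K H)
        ((T.J⁻¹ : (H ⊗[K] H)ˣ) : H ⊗[K] H)) = 1 := by
  have h := congrArg (fun x => Algebra.TensorProduct.lid K H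
      (Algebra.TensorProduct.map (Bialgebra.counitAlgHom K H) (AlgHom.id K H) x)) T.J.mul_inv
  simpa only [map_mul, T.counit_left, one_mul, map_one] using h

theorem counit_right_inv :
    Algebra.TensorProduct.rid K K H
      (Algebra.TensorProduct.map (AlgHom.id K H) (Bialgebra.counitAlgHom K H)
        ((T.J⁻¹ : (H ⊗[K] H)ˣ) : H ⊗[K] H)) = 1 := by
  have h := congrArg (fun x => Algebra.TensorProduct.rid K K H
      (Algebra.TensorProduct.map (AlgHom.id K H) (Bialgebra.counitAlgHom K H) x)) T.J.mul_inv
  simpa only [map_mul, T.counit_right, one_mul, map_one] using h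

theorem U_mul_Uinv : T.U * T.Uinv = 1 := by
  have hB : Algebra.TensorProduct.assoc K K K H H H
        (Algebra.TensorProduct.map (Bialgebra.comulAlgHom K H) (AlgHom.id K H)
          (T.J : H ⊗[K] H)) *
      Algebra.TensorProduct.assoc K K K H H H
        (Algebra.TensorProduct.map (Bialgebra.comulAlgHom K H) (AlgHom.id K H)
          ((T.J⁻¹ : (H ⊗[K] H)ˣ) : H ⊗[K] H)) = 1 := by
    rw [← map_mul, ← map_mul, T.J.mul_inv, map_one, map_one]
  have hJ : ((1 : H) ⊗ₜ[K] ((T.J⁻¹ : (H ⊗[K] H)ˣ) : H ⊗[K] H)) * (1 ⊗ₜ (T.J : H ⊗[K] H)) = 1 := by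
    rw [Algebra.TensorProduct.tmul_mul_tmul, T.J.inv_mul, one_mul]; rfl
  have hc := T.cocycle
  rw [map_mul] at hc
  have key : Algebra.TensorProduct.map (AlgHom.id K H) (Bialgebra.comulAlgHom K H)
        (T.J : H ⊗[K] H) *
      Algebra.TensorProduct.assoc K K K H H H
        (Algebra.TensorProduct.map (Bialgebra.comulAlgHom K H) (AlgHom.id K H)
          ((T.J⁻¹ : (H ⊗[K] H)ˣ) : H ⊗[K] H)) =
      ((1 : H) ⊗ₜ[K] ((T.J⁻¹ : (H ⊗[K] H)ˣ) : H ⊗[K] H)) *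
        Algebra.TensorProduct.assoc K K K H H H ((T.J : H ⊗[K] H) ⊗ₜ[K] 1) := by
    have h1 := congrArg (fun x => ((1 : H) ⊗ₜ[K] ((T.J⁻¹ : (H ⊗[K] H)ˣ) : H ⊗[K] H)) * x) hc
    simp only [← mul_assoc] at h1
    rw [hJ, one_mul] at h1
    rw [h1, mul_assoc, hB, mul_one]
  have h2 := tripleMap_map_mul_map (T.J : H ⊗[K] H) ((T.J⁻¹ : (H ⊗[K] H)ˣ) : H ⊗[K] H)
  rw [key, tripleMap_tmul_mul_assoc, T.counit_right, T.counit_left_inv, one_mul, mul_one,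
    one_mul, ← T.Uinv_eq] at h2
  rw [U_eq, h2]

/-- The comultiplication `Δ_J(h) = J Δ(h) J⁻¹`. -/
noncomputable def comul : H →ₐ[K] H ⊗[K] H :=
  (conjAlgHom K T.J).comp (Bialgebra.comulAlgHom K H)

/-- The antipode `S_J(h) = U_J S(h) U_J⁻¹`. -/
noncomputable def antipode : H →ₗ[K] H :=
  LinearMap.mulLeft K T.U ∘ₗ LinearMap.mulRight K T.Uinv ∘ₗ HopfAlgebra.antipode K

theorem comul_apply (h : H) : T.comul h =
    (T.J : H ⊗[K] H) * Coalgebra.comul (R := K) h * ((T.J⁻¹ : (H ⊗[K] H)ˣ) : H ⊗[K] H) := by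
  simp [comul, conjAlgHom_apply]

theorem antipode_apply (h : H) :
    T.antipode h = T.U * HopfAlgebra.antipode K h * T.Uinv := by
  simp [antipode, mul_assoc]

theorem coassoc :
    (Algebra.TensorProduct.assoc K K K H H H).toAlgHom.comp
      ((Algebra.TensorProduct.map T.comul (.id K H)).comp T.comul)
      = (Algebra.TensorProduct.map (.id K H) T.comul).comp T.comul := by
  have hl : ∀ x : H ⊗[K] H, Algebra.TensorProduct.map T.comul (AlgHom.id K H) x =
      ((T.J : H ⊗[K] H) ⊗ₜ[K] (1 : H)) *
        Algebra.TensorProduct.map (Bialgebra.comulAlgHom K H) (AlgHom.id K H) x *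
        (((T.J⁻¹ : (H ⊗[K] H)ˣ) : H ⊗[K] H) ⊗ₜ[K] (1 : H)) := by
    intro x
    induction x using TensorProduct.induction_on with
    | zero => simp
    | add x y hx hy => simp only [map_add, hx, hy, mul_add, add_mul]
    | tmul x y => simp [comul_apply]
  have hr : ∀ x : H ⊗[K] H, Algebra.TensorProduct.map (AlgHom.id K H) T.comul x =
      ((1 : H) ⊗ₜ[K] (T.J : H ⊗[K] H)) *
        Algebra.TensorProduct.map (AlgHom.id K H) (Bialgebra.comulAlgHom K H) x *
        ((1 : H) ⊗ₜ[K] ((T.J⁻¹ : (H ⊗[K] H)ˣ) : H ⊗[K] H)) := by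
    intro x
    induction x using TensorProduct.induction_on with
    | zero => simp
    | add x y hx hy => simp only [map_add, hx, hy, mul_add, add_mul]
    | tmul x y => simp [comul_apply]
  -- the inverse form of the cocycle identity
  have hinv :
      Algebra.TensorProduct.map (AlgHom.id K H) (Bialgebra.comulAlgHom K H)
          ((T.J⁻¹ : (H ⊗[K] H)ˣ) : H ⊗[K] H) *
        ((1 : H) ⊗ₜ[K] ((T.J⁻¹ : (H ⊗[K] H)ˣ) : H ⊗[K] H)) =
      Algebra.TensorProduct.assoc K K K H H H
        (Algebra.TensorProduct.map (Bialgebra.comulAlgHom K H) (AlgHom.id K H)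
            ((T.J⁻¹ : (H ⊗[K] H)ˣ) : H ⊗[K] H) *
          (((T.J⁻¹ : (H ⊗[K] H)ˣ) : H ⊗[K] H) ⊗ₜ[K] (1 : H))) := by
    refine left_inv_eq_right_inv (a := ((1 : H) ⊗ₜ[K] (T.J : H ⊗[K] H)) *
        Algebra.TensorProduct.map (AlgHom.id K H) (Bialgebra.comulAlgHom K H)
          (T.J : H ⊗[K] H)) ?_ ?_
    · rw [mul_assoc, ← mul_assoc ((1 : H) ⊗ₜ[K] _), Algebra.TensorProduct.tmul_mul_tmul,
        T.J.inv_mul, one_mul, ← Algebra.TensorProduct.one_def, one_mul, ← map_mul, T.J.inv_mul,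
        map_one]
    · rw [T.cocycle, ← map_mul, mul_assoc,
        ← mul_assoc (Algebra.TensorProduct.map (Bialgebra.comulAlgHom K H) (AlgHom.id K H) _),
        ← map_mul, T.J.mul_inv, map_one, one_mul, Algebra.TensorProduct.tmul_mul_tmul,
        T.J.mul_inv, one_mul, ← Algebra.TensorProduct.one_def, map_one]
  have hco : ∀ h : H, Algebra.TensorProduct.assoc K K K H H H
      (Algebra.TensorProduct.map (Bialgebra.comulAlgHom K H) (AlgHom.id K H)
        (Coalgebra.comul (R := K) h)) =
      Algebra.TensorProduct.map (AlgHom.id K H) (Bialgebra.comulAlgHom K H)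
        (Coalgebra.comul (R := K) h) := fun h => Coalgebra.coassoc_apply h
  ext h
  change Algebra.TensorProduct.assoc K K K H H H
      (Algebra.TensorProduct.map T.comul (.id K H) (T.comul h)) =
    Algebra.TensorProduct.map (.id K H) T.comul (T.comul h)
  rw [hl, hr, T.comul_apply, map_mul, map_mul, map_mul, map_mul]
  calc _ = Algebra.TensorProduct.assoc K K K H H H
          (((T.J : H ⊗[K] H) ⊗ₜ[K] 1) *
            Algebra.TensorProduct.map (Bialgebra.comulAlgHom K H) (AlgHom.id K H)
              (T.J : H ⊗[K] H)) *
        Algebra.TensorProduct.assoc K K K H H H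
          (Algebra.TensorProduct.map (Bialgebra.comulAlgHom K H) (AlgHom.id K H)
            (Coalgebra.comul (R := K) h)) *
        Algebra.TensorProduct.assoc K K K H H H
          (Algebra.TensorProduct.map (Bialgebra.comulAlgHom K H) (AlgHom.id K H)
              ((T.J⁻¹ : (H ⊗[K] H)ˣ) : H ⊗[K] H) *
            (((T.J⁻¹ : (H ⊗[K] H)ˣ) : H ⊗[K] H) ⊗ₜ[K] (1 : H))) := by
        simp only [map_mul, mul_assoc]
    _ = _ := by
        rw [← T.cocycle, ← hinv, hco]
        simp only [mul_assoc, map_mul]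

theorem counit_comul_left :
    (Algebra.TensorProduct.map (Bialgebra.counitAlgHom K H) (.id K H)).comp T.comul
      = (Algebra.TensorProduct.lid K H).symm := by
  ext h
  apply (Algebra.TensorProduct.lid K H).injective
  change Algebra.TensorProduct.lid K H
    (Algebra.TensorProduct.map (Bialgebra.counitAlgHom K H) (.id K H) (T.comul h)) =
      Algebra.TensorProduct.lid K H ((Algebra.TensorProduct.lid K H).symm h)
  rw [T.comul_apply, map_mul, map_mul, map_mul, map_mul, T.counit_left, T.counit_left_inv,
    one_mul, mul_one]
  have : Algebra.TensorProduct.map (Bialgebra.counitAlgHom K H) (.id K H)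
      (Coalgebra.comul (R := K) h) = (1 : K) ⊗ₜ[K] h := Coalgebra.rTensor_counit_comul h
  rw [this]
  simp

theorem counit_comul_right :
    (Algebra.TensorProduct.map (.id K H) (Bialgebra.counitAlgHom K H)).comp T.comul
      = (Algebra.TensorProduct.rid K K H).symm := by
  ext h
  apply (Algebra.TensorProduct.rid K K H).injective
  change Algebra.TensorProduct.rid K K H
    (Algebra.TensorProduct.map (.id K H) (Bialgebra.counitAlgHom K H) (T.comul h)) =
      Algebra.TensorProduct.rid K K H ((Algebra.TensorProduct.rid K K H).symm h)
  rw [T.comul_apply, map_mul, map_mul, map_mul, map_mul, T.counit_right, T.counit_right_inv,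
    one_mul, mul_one]
  have : Algebra.TensorProduct.map (.id K H) (Bialgebra.counitAlgHom K H)
      (Coalgebra.comul (R := K) h) = h ⊗ₜ[K] (1 : K) := Coalgebra.lTensor_counit_comul h
  rw [this]
  simp

theorem antipode_left (h : H) :
    LinearMap.mul' K H (T.antipode.rTensor H (T.comul h)) =
      algebraMap K H (Coalgebra.counit h) := by
  have hx : ∀ x : H ⊗[K] H, LinearMap.mul' K H (T.antipode.rTensor H x) =
      T.U * sandwichLeft (K := K) T.Uinv x := by
    intro x
    induction x using TensorProduct.induction_on with
    | zero => simp
    | add x y hx hy => simp only [map_add, hx, hy, mul_add]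
    | tmul x y => simp [antipode_apply, sandwichLeft_tmul, mul_assoc]
  rw [hx, T.comul_apply, sandwichLeft_mul, sandwichLeft_mul]
  have h1 : sandwichLeft (K := K) T.Uinv (T.J : H ⊗[K] H) = 1 := by
    rw [T.Uinv_eq, ← sandwichLeft_mul, T.J.inv_mul, sandwichLeft_one]
  rw [h1, sandwichLeft_one_comul, sandwichLeft_smul_one, ← T.Uinv_eq, mul_smul_comm, T.U_mul_Uinv]
  rw [Algebra.algebraMap_eq_smul_one]

theorem antipode_right (h : H) :
    LinearMap.mul' K H (T.antipode.lTensor H (T.comul h)) =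
      algebraMap K H (Coalgebra.counit h) := by
  have hx : ∀ x : H ⊗[K] H, LinearMap.mul' K H (T.antipode.lTensor H x) =
      sandwichRight (K := K) T.U x * T.Uinv := by
    intro x
    induction x using TensorProduct.induction_on with
    | zero => simp
    | add x y hx hy => simp only [map_add, hx, hy, add_mul]
    | tmul x y => simp [antipode_apply, sandwichRight_tmul, mul_assoc]
  rw [hx, T.comul_apply, sandwichRight_mul, sandwichRight_mul]
  have h1 : sandwichRight (K := K) T.U ((T.J⁻¹ : (H ⊗[K] H)ˣ) : H ⊗[K] H) = 1 := by
    rw [T.U_eq, ← sandwichRight_mul, T.J.inv_mul, sandwichRight_one]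
  rw [h1, sandwichRight_one_comul, sandwichRight_smul_one, ← T.U_eq, smul_mul_assoc, T.U_mul_Uinv]
  rw [Algebra.algebraMap_eq_smul_one]

end

/-- The underlying algebra of the Drinfel'd twist `H_J`: it is `H`. -/
def Twisted {K H : Type*} [CommRing K] [Ring H] [HopfAlgebra K H] (_T : HopfTwist K H) :
    Type _ := H

variable {K H : Type*} [CommRing K] [Ring H] [HopfAlgebra K H] (T : HopfTwist K H)

instance : Ring T.Twisted := inferInstanceAs (Ring H)
instance : Algebra K T.Twisted := inferInstanceAs (Algebra K H)

/-- The Hopf algebra `H_J`: the algebra and the counit of `H`, with comultiplication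
`Δ_J(h) = J Δ(h) J⁻¹` and antipode `S_J(h) = U_J S(h) U_J⁻¹`. -/
noncomputable instance : HopfAlgebra K T.Twisted :=
  letI : Bialgebra K H := Bialgebra.ofAlgHom T.comul (Bialgebra.counitAlgHom K H)
    T.coassoc T.counit_comul_left T.counit_comul_right
  letI : HopfAlgebra K H :=
   { antipode := T.antipode
     mul_antipode_rTensor_comul := LinearMap.ext T.antipode_left
     mul_antipode_lTensor_comul := LinearMap.ext T.antipode_right }
  inferInstanceAs (HopfAlgebra K H)

theorem twisted_comul (h : H) : Coalgebra.comul (R := K) (A := T.Twisted) h =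
    (T.J : H ⊗[K] H) * Coalgebra.comul (R := K) h * ((T.J⁻¹ : (H ⊗[K] H)ˣ) : H ⊗[K] H) :=
  T.comul_apply h

theorem twisted_counit (h : H) :
    Coalgebra.counit (R := K) (A := T.Twisted) h = Coalgebra.counit (R := K) h := rfl

theorem twisted_antipode (h : H) : HopfAlgebra.antipode K (A := T.Twisted) h =
    (T.U * HopfAlgebra.antipode K h * T.Uinv : H) :=
  T.antipode_apply h

end HopfTwist

namespace BicharacterTwist

section

variable {K H : Type*} [Field K] [Ring H] [HopfAlgebra K H]

/-- The element `(1/p) ∑_{u,v=0}^{p-1} c^{uv} t^u ⊗ s^v` of `H ⊗ H`. -/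
noncomputable def tensorSum (p : ℕ) (c : K) (t s : H) : H ⊗[K] H :=
  (p : K)⁻¹ • ∑ u ∈ Finset.range p, ∑ v ∈ Finset.range p, c ^ (u * v) • ((t ^ u) ⊗ₜ[K] (s ^ v))

variable {p : ℕ} [Fact p.Prime]

theorem pow_val_add {x : H} (hx : x ^ p = 1) (i j : ZMod p) :
    x ^ (i + j).val = x ^ i.val * x ^ j.val := by
  rw [ZMod.val_add, ← pow_add, ← pow_eq_pow_mod _ hx]

/-- The idempotents `(1/p) ∑_u χ(-ui) t^u`. -/
noncomputable def idem (χ : AddChar (ZMod p) K) (t : H) (i : ZMod p) : H :=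
  (p : K)⁻¹ • ∑ u : ZMod p, χ (-(u * i)) • t ^ u.val

theorem pow_mul_idem (χ : AddChar (ZMod p) K) {t : H} (ht : t ^ p = 1) (u i : ZMod p) :
    t ^ u.val * idem χ t i = χ (u * i) • idem χ t i := by
  rw [idem, mul_smul_comm, smul_comm, Finset.mul_sum]
  congr 1
  rw [Finset.smul_sum]
  refine Fintype.sum_equiv (Equiv.addLeft u) _ _ fun w => ?_
  rw [mul_smul_comm, ← pow_val_add ht, smul_smul, ← AddChar.map_add_eq_mul]
  simp only [Equiv.coe_addLeft]
  congr 2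
  ring

theorem idem_mul_pow (χ : AddChar (ZMod p) K) {t : H} (ht : t ^ p = 1) (u i : ZMod p) :
    idem χ t i * t ^ u.val = χ (u * i) • idem χ t i := by
  rw [← pow_mul_idem χ ht]
  have h : Commute (t ^ u.val) (idem χ t i) := by
    refine Commute.smul_right (Commute.sum_right _ _ _ fun w _ => ?_) _
    exact Commute.smul_right ((Commute.refl t).pow_pow _ _) _
  exact h.eq.symm

theorem idem_mul_idem [CharZero K] {χ : AddChar (ZMod p) K} (hχ : χ.IsPrimitive) {t : H} (ht : t ^ p = 1)
    (i j : ZMod p) : idem χ t i * idem χ t j = if i = j then idem χ t j else 0 := by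
  have hp : (p : K) ≠ 0 := Nat.cast_ne_zero.mpr (Fact.out : p.Prime).ne_zero
  conv_lhs => rw [idem]
  rw [smul_mul_assoc, Finset.sum_mul]
  have h : ∀ u : ZMod p, (χ (-(u * i)) • t ^ u.val) * idem χ t j =
      χ (u * (j - i)) • idem χ t j := by
    intro u
    rw [smul_mul_assoc, pow_mul_idem χ ht, smul_smul, ← AddChar.map_add_eq_mul]
    congr 2
    ring
  rw [Finset.sum_congr rfl fun u _ => h u, ← Finset.sum_smul, AddChar.sum_mulShift _ hχ]
  by_cases hij : i = j
  · subst hij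
    simp [ZMod.card, smul_smul, hp]
  · rw [if_neg hij, if_neg (sub_ne_zero.mpr (Ne.symm hij))]
    simp

theorem sum_idem [CharZero K] {χ : AddChar (ZMod p) K} (hχ : χ.IsPrimitive) (t : H) :
    ∑ i, idem χ t i = 1 := by
  have hp : (p : K) ≠ 0 := Nat.cast_ne_zero.mpr (Fact.out : p.Prime).ne_zero
  simp only [idem]
  rw [← Finset.smul_sum, Finset.sum_comm]
  have h : ∀ u : ZMod p, ∑ i : ZMod p, χ (-(u * i)) • t ^ u.val =
      if u = 0 then (p : K) • (1 : H) else 0 := by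
    intro u
    rw [← Finset.sum_smul]
    have h2 : ∀ i : ZMod p, χ (-(u * i)) = χ (i * (-u)) := fun i => by congr 1; ring
    rw [Finset.sum_congr rfl fun i _ => h2 i, AddChar.sum_mulShift _ hχ]
    by_cases hu : u = 0
    · subst hu; simp [ZMod.card]
    · simp [hu]
  rw [Finset.sum_congr rfl fun u _ => h u]
  simp [smul_smul, hp]

theorem sum_range_eq {M : Type*} [AddCommMonoid M] (f : ℕ → M) :
    ∑ u ∈ Finset.range p, f u = ∑ u : ZMod p, f u.val := by
  refine Finset.sum_bij' (fun u _ => (u : ZMod p)) (fun u _ => u.val) (fun _ _ => by simp)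
    (fun u _ => by simpa using ZMod.val_lt u)
    (fun u hu => ZMod.val_cast_of_lt (by simpa using hu)) (fun u _ => by simp)
    (fun u hu => by rw [ZMod.val_cast_of_lt (by simpa using hu)])

theorem tensorSum_eq (χ : AddChar (ZMod p) K) {c : K}
    (hc : ∀ u v : ZMod p, c ^ (u.val * v.val) = χ (-(u * v))) (t s : H) :
    tensorSum p c t s = ∑ i : ZMod p, idem χ t i ⊗ₜ[K] (s ^ i.val) := by
  rw [tensorSum, sum_range_eq]
  simp only [sum_range_eq, hc, idem]
  rw [Finset.sum_comm, Finset.smul_sum]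
  refine Finset.sum_congr rfl fun i _ => ?_
  rw [← TensorProduct.smul_tmul', TensorProduct.sum_tmul]
  simp only [TensorProduct.smul_tmul']

theorem sum_mul_sum [CharZero K] {χ : AddChar (ZMod p) K} (hχ : χ.IsPrimitive) {t s : H} (ht : t ^ p = 1)
    (hs : s ^ p = 1) :
    (∑ i : ZMod p, idem χ t i ⊗ₜ[K] (s ^ i.val)) *
      (∑ i : ZMod p, idem χ t i ⊗ₜ[K] (s ^ (-i).val)) = 1 := by
  rw [Finset.sum_mul]
  have h : ∀ i : ZMod p, (idem χ t i ⊗ₜ[K] (s ^ i.val)) *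
      (∑ j : ZMod p, idem χ t j ⊗ₜ[K] (s ^ (-j).val)) = idem χ t i ⊗ₜ[K] (1 : H) := by
    intro i
    rw [Finset.mul_sum, Finset.sum_eq_single i]
    · rw [Algebra.TensorProduct.tmul_mul_tmul, idem_mul_idem hχ ht, if_pos rfl,
        ← pow_val_add hs]
      simp
    · intro j _ hj
      rw [Algebra.TensorProduct.tmul_mul_tmul, idem_mul_idem hχ ht, if_neg (Ne.symm hj),
        TensorProduct.zero_tmul]
    · simp
  rw [Finset.sum_congr rfl fun i _ => h i, ← TensorProduct.sum_tmul, sum_idem hχ,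
    Algebra.TensorProduct.one_def]

theorem sum_mul_sum' [CharZero K] {χ : AddChar (ZMod p) K} (hχ : χ.IsPrimitive) {t s : H} (ht : t ^ p = 1)
    (hs : s ^ p = 1) :
    (∑ i : ZMod p, idem χ t i ⊗ₜ[K] (s ^ (-i).val)) *
      (∑ i : ZMod p, idem χ t i ⊗ₜ[K] (s ^ i.val)) = 1 := by
  rw [Finset.sum_mul]
  have h : ∀ i : ZMod p, (idem χ t i ⊗ₜ[K] (s ^ (-i).val)) *
      (∑ j : ZMod p, idem χ t j ⊗ₜ[K] (s ^ j.val)) = idem χ t i ⊗ₜ[K] (1 : H) := by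
    intro i
    rw [Finset.mul_sum, Finset.sum_eq_single i]
    · rw [Algebra.TensorProduct.tmul_mul_tmul, idem_mul_idem hχ ht, if_pos rfl,
        ← pow_val_add hs]
      simp
    · intro j _ hj
      rw [Algebra.TensorProduct.tmul_mul_tmul, idem_mul_idem hχ ht, if_neg (Ne.symm hj),
        TensorProduct.zero_tmul]
    · simp
  rw [Finset.sum_congr rfl fun i _ => h i, ← TensorProduct.sum_tmul, sum_idem hχ,
    Algebra.TensorProduct.one_def]

theorem counit_idem [CharZero K] {χ : AddChar (ZMod p) K} (hχ : χ.IsPrimitive) {t : H}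
    (ht : IsGroupLikeElem K t) (i : ZMod p) :
    Coalgebra.counit (R := K) (idem χ t i) = if i = 0 then 1 else 0 := by
  have hp : (p : K) ≠ 0 := Nat.cast_ne_zero.mpr (Fact.out : p.Prime).ne_zero
  have h2 : ∀ u : ZMod p, χ (-(u * i)) = χ (u * (-i)) := fun u => by congr 1; ring
  simp only [idem, map_smul, map_sum, Bialgebra.counit_pow, ht.counit_eq_one, one_pow,
    smul_eq_mul, mul_one, h2]
  rw [AddChar.sum_mulShift _ hχ]
  by_cases hi : i = 0
  · simp [hi, ZMod.card, hp]
  · simp [hi]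

theorem sum_cocycle {χ : AddChar (ZMod p) K} {t s : H}
    (htp : t ^ p = 1) (hsp : s ^ p = 1) (hts : Commute t s)
    (ht : IsGroupLikeElem K t) (hs : IsGroupLikeElem K s) :
    (1 ⊗ₜ[K] (∑ i : ZMod p, idem χ t i ⊗ₜ[K] (s ^ i.val))) *
        Algebra.TensorProduct.map (AlgHom.id K H) (Bialgebra.comulAlgHom K H)
          (∑ i : ZMod p, idem χ t i ⊗ₜ[K] (s ^ i.val)) =
      Algebra.TensorProduct.assoc K K K H H H
        (((∑ i : ZMod p, idem χ t i ⊗ₜ[K] (s ^ i.val)) ⊗ₜ[K] 1) *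
          Algebra.TensorProduct.map (Bialgebra.comulAlgHom K H) (AlgHom.id K H)
            (∑ i : ZMod p, idem χ t i ⊗ₜ[K] (s ^ i.val))) := by
  have hcomm : ∀ u v : ℕ, s ^ u * t ^ v = t ^ v * s ^ u := fun u v =>
    (hts.symm.pow_pow u v).eq
  have hidem : ∀ (u : ℕ) (j : ZMod p), s ^ u * idem χ t j = idem χ t j * s ^ u := by
    intro u j
    rw [idem, mul_smul_comm, smul_mul_assoc, Finset.mul_sum, Finset.sum_mul]
    congr 1
    refine Finset.sum_congr rfl fun v _ => ?_
    rw [mul_smul_comm, smul_mul_assoc, hcomm]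
  -- both sides equal `∑_{i,j} f_i ⊗ (f_j s^i ⊗ s^(j+i))`
  have hL : (1 ⊗ₜ[K] (∑ i : ZMod p, idem χ t i ⊗ₜ[K] (s ^ i.val))) *
        Algebra.TensorProduct.map (AlgHom.id K H) (Bialgebra.comulAlgHom K H)
          (∑ i : ZMod p, idem χ t i ⊗ₜ[K] (s ^ i.val)) =
      ∑ i : ZMod p, ∑ j : ZMod p,
        idem χ t i ⊗ₜ[K] ((idem χ t j * s ^ i.val) ⊗ₜ[K] (s ^ (j + i).val)) := by
    rw [map_sum, Finset.mul_sum]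
    refine Finset.sum_congr rfl fun i _ => ?_
    rw [Algebra.TensorProduct.map_tmul, AlgHom.coe_id, id_eq, Bialgebra.comulAlgHom_apply,
      Bialgebra.comul_pow, hs.comul_eq_tmul_self, Algebra.TensorProduct.tmul_pow,
      Algebra.TensorProduct.tmul_mul_tmul, one_mul, Finset.sum_mul, TensorProduct.tmul_sum]
    refine Finset.sum_congr rfl fun j _ => ?_
    rw [Algebra.TensorProduct.tmul_mul_tmul, pow_val_add hsp]
  rw [hL, Finset.sum_comm' (t' := Finset.univ) (s' := fun _ => Finset.univ) (by simp),
    TensorProduct.sum_tmul, Finset.sum_mul, map_sum, Finset.sum_comm]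
  refine Finset.sum_congr rfl fun i _ => ?_
  -- the summand of index `i`
  have hstep : ∀ v : ZMod p,
      Algebra.TensorProduct.assoc K K K H H H
        (((idem χ t i ⊗ₜ[K] (s ^ i.val)) ⊗ₜ[K] (1 : H)) *
          Algebra.TensorProduct.map (Bialgebra.comulAlgHom K H) (AlgHom.id K H)
            (idem χ t v ⊗ₜ[K] (s ^ v.val))) =
      idem χ t i ⊗ₜ[K] ((idem χ t (v - i) * s ^ i.val) ⊗ₜ[K] (s ^ v.val)) := by
    intro v
    have hco : Coalgebra.comul (R := K) (idem χ t v) =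
        (p : K)⁻¹ • ∑ u : ZMod p, χ (-(u * v)) • ((t ^ u.val) ⊗ₜ[K] (t ^ u.val)) := by
      simp only [idem, map_smul, map_sum, Bialgebra.comul_pow, ht.comul_eq_tmul_self,
        Algebra.TensorProduct.tmul_pow]
    have hmul : (idem χ t i ⊗ₜ[K] (s ^ i.val)) * Coalgebra.comul (R := K) (idem χ t v) =
        idem χ t i ⊗ₜ[K] (idem χ t (v - i) * s ^ i.val) := by
      rw [hco, mul_smul_comm, Finset.mul_sum, ← hidem]
      conv_rhs => rw [idem.eq_def χ t (v - i), mul_smul_comm, TensorProduct.tmul_smul,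
        Finset.mul_sum, TensorProduct.tmul_sum]
      congr 1
      refine Finset.sum_congr rfl fun u _ => ?_
      rw [mul_smul_comm, Algebra.TensorProduct.tmul_mul_tmul, idem_mul_pow χ htp,
        ← TensorProduct.smul_tmul', smul_smul, ← AddChar.map_add_eq_mul, mul_smul_comm,
        TensorProduct.tmul_smul]
      congr 2
      ring
    rw [Algebra.TensorProduct.map_tmul, AlgHom.coe_id, id_eq, Bialgebra.comulAlgHom_apply,
      Algebra.TensorProduct.tmul_mul_tmul, hmul, one_mul, Algebra.TensorProduct.assoc_tmul]
  rw [map_sum, Finset.mul_sum, map_sum, Finset.sum_congr rfl fun v _ => hstep v]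
  refine Fintype.sum_equiv (Equiv.addRight i) _ _ fun j => ?_
  simp

theorem pow_val_mul {c : K} (hc : c ^ p = 1) (u v : ZMod p) :
    c ^ (u.val * v.val) = c ^ (u * v).val := by
  rw [ZMod.val_mul, ← pow_eq_pow_mod _ hc]

theorem tensorSum_inv_eq {ζ : K} (hζ : IsPrimitiveRoot ζ p) (t s : H) :
    tensorSum p ζ⁻¹ t s = ∑ i : ZMod p,
      idem (AddChar.zmodChar p hζ.pow_eq_one) t i ⊗ₜ[K] (s ^ i.val) := by
  refine tensorSum_eq _ (fun u v => ?_) t s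
  rw [pow_val_mul (by rw [inv_pow, hζ.pow_eq_one, inv_one]), AddChar.map_neg_eq_inv,
    AddChar.zmodChar_apply, inv_pow]

theorem tensorSum_eq' {ζ : K} (hζ : IsPrimitiveRoot ζ p) {t s : H} :
    tensorSum p ζ t s = ∑ i : ZMod p,
      idem (AddChar.zmodChar p hζ.pow_eq_one) t i ⊗ₜ[K] (s ^ (-i).val) := by
  rw [← Fintype.sum_equiv (Equiv.neg (ZMod p))
    (fun i => idem (AddChar.zmodChar p hζ.pow_eq_one) t (-i) ⊗ₜ[K] (s ^ i.val)) _
    (fun i => by simp)]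
  rw [tensorSum, sum_range_eq]
  simp only [sum_range_eq, idem]
  rw [Finset.sum_comm, Finset.smul_sum]
  refine Finset.sum_congr rfl fun i _ => ?_
  rw [← TensorProduct.smul_tmul', TensorProduct.sum_tmul]
  simp only [TensorProduct.smul_tmul', pow_val_mul hζ.pow_eq_one, mul_neg, neg_neg,
    AddChar.zmodChar_apply]

/-- For commuting group-like elements `t, s` with `t^p = s^p = 1` and a primitive `p`-th root of
unity `ζ`, the twist `(1/p) ∑_{u,v=0}^{p-1} ζ^{-uv} t^u ⊗ s^v`, whose inverse is
`(1/p) ∑_{u,v=0}^{p-1} ζ^{uv} t^u ⊗ s^v`. -/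
noncomputable def twist [CharZero K] {ζ : K} (hζ : IsPrimitiveRoot ζ p) {t s : H}
    (htp : t ^ p = 1) (hsp : s ^ p = 1) (hts : Commute t s)
    (ht : IsGroupLikeElem K t) (hs : IsGroupLikeElem K s) : HopfTwist K H where
  J :=
    { val := tensorSum p ζ⁻¹ t s
      inv := tensorSum p ζ t s
      val_inv := by
        rw [tensorSum_inv_eq hζ, tensorSum_eq' hζ]
        exact sum_mul_sum (AddChar.zmodChar_primitive_of_primitive_root p hζ) htp hsp
      inv_val := by
        rw [tensorSum_inv_eq hζ, tensorSum_eq' hζ]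
        exact sum_mul_sum' (AddChar.zmodChar_primitive_of_primitive_root p hζ) htp hsp }
  cocycle := by
    dsimp only
    rw [tensorSum_inv_eq hζ]
    exact sum_cocycle htp hsp hts ht hs
  counit_left := by
    have hχ := AddChar.zmodChar_primitive_of_primitive_root p hζ
    dsimp only
    rw [tensorSum_inv_eq hζ, map_sum, map_sum, Finset.sum_eq_single 0]
    · simp [counit_idem hχ ht]
    · intro i _ hi
      simp [counit_idem hχ ht, hi]
    · simp
  counit_right := by
    have hχ := AddChar.zmodChar_primitive_of_primitive_root p hζ
    dsimp only
    rw [tensorSum_inv_eq hζ, map_sum, map_sum]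
    simp [hs.counit_eq_one, sum_idem hχ]

end

end BicharacterTwist

section GroupDefinition

variable {p q : ℕ} [Fact p.Prime] (r : (ZMod q)ˣ) (hr : orderOf r = p)

/-- The homomorphism `ℤ_p → ℤ_q^×`, `i ↦ r^i`, for `r` of order `p`. -/
def unitPowHom : Multiplicative (ZMod p) →* (ZMod q)ˣ where
  toFun i := r ^ (Multiplicative.toAdd i).val
  map_one' := by simp
  map_mul' i j := by
    have h : r ^ p = 1 := by rw [← hr, pow_orderOf_eq_one]
    rw [toAdd_mul, ZMod.val_add, ← pow_add, ← pow_eq_pow_mod _ h]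

/-- The action of `ℤ_p` on `ℤ_q` in which `i` acts by multiplication by `r^i`. -/
def unitPowAction : Multiplicative (ZMod p) →* MulAut (Multiplicative (ZMod q)) where
  toFun i := AddEquiv.toMultiplicative (DistribMulAction.toAddEquiv (ZMod q) (unitPowHom r hr i))
  map_one' := by ext x; simp
  map_mul' i j := by ext x; simp [mul_smul]

/-- The semidirect product `ℤ_q ⋊ ℤ_p = ⟨σ, a : σ^p = a^q = 1, σ a σ⁻¹ = a^r⟩`. -/
abbrev SemidirectFactor : Type :=
  Multiplicative (ZMod q) ⋊[unitPowAction r hr] Multiplicative (ZMod p)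

/-- The group `G = (ℤ_q × ℤ_q) ⋊ (ℤ_p × ℤ_p)` with generators `σ, τ, a, b` and relations
`σ^p = τ^p = 1`, `a^q = b^q = 1`, `σ a σ⁻¹ = a^r`, `τ b τ⁻¹ = b^r`,
`[σ,b] = [τ,a] = [a,b] = [σ,τ] = 1`, written as the direct product of `⟨σ, a⟩` and `⟨τ, b⟩`. -/
abbrev GNGroup : Type := SemidirectFactor r hr × SemidirectFactor r hr

namespace GNGroup

/-- The generator `σ`. -/
def sigma : GNGroup r hr := (SemidirectProduct.inr (Multiplicative.ofAdd 1), 1)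

/-- The generator `τ`. -/
def tau : GNGroup r hr := (1, SemidirectProduct.inr (Multiplicative.ofAdd 1))

/-- The generator `a`. -/
def a : GNGroup r hr := (SemidirectProduct.inl (Multiplicative.ofAdd 1), 1)

/-- The generator `b`. -/
def b : GNGroup r hr := (1, SemidirectProduct.inl (Multiplicative.ofAdd 1))

theorem sigma_pow : sigma r hr ^ p = 1 := by
  ext1
  · simp [sigma, ← map_pow, ← ofAdd_nsmul]
  · simp [sigma]

theorem tau_pow : tau r hr ^ p = 1 := by
  ext1
  · simp [tau]
  · simp [tau, ← map_pow, ← ofAdd_nsmul]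

theorem tau_commute_sigma : Commute (tau r hr) (sigma r hr) := by
  ext1 <;> simp [tau, sigma]

theorem a_pow : a r hr ^ q = 1 := by
  ext1
  · simp [a, ← map_pow, ← ofAdd_nsmul]
  · simp [a]

theorem b_pow : b r hr ^ q = 1 := by
  ext1
  · simp [b]
  · simp [b, ← map_pow, ← ofAdd_nsmul]

theorem inr_mul_inl [NeZero q] :
    (SemidirectProduct.inr (Multiplicative.ofAdd 1) : SemidirectFactor r hr) *
        SemidirectProduct.inl (Multiplicative.ofAdd 1) *
        (SemidirectProduct.inr (Multiplicative.ofAdd 1))⁻¹ =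
      SemidirectProduct.inl (Multiplicative.ofAdd 1) ^ (r : ZMod q).val := by
  have h1 : r ^ (1 : ZMod p).val = r := by
    rw [ZMod.val_one, pow_one]
  rw [← map_inv, ← SemidirectProduct.inl_aut, ← map_pow, ← ofAdd_nsmul]
  congr 1
  simp [unitPowAction, unitPowHom, h1, Units.smul_def]

theorem sigma_mul_a [NeZero q] :
    sigma r hr * a r hr * (sigma r hr)⁻¹ = a r hr ^ (r : ZMod q).val := by
  ext1
  · exact inr_mul_inl r hr
  · simp [sigma, a]

theorem tau_mul_b [NeZero q] :
    tau r hr * b r hr * (tau r hr)⁻¹ = b r hr ^ (r : ZMod q).val := by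
  ext1
  · simp [tau, b]
  · exact inr_mul_inl r hr

theorem sigma_commute_b : Commute (sigma r hr) (b r hr) := by
  ext1 <;> simp [sigma, b]

theorem tau_commute_a : Commute (tau r hr) (a r hr) := by
  ext1 <;> simp [tau, a]

theorem a_commute_b : Commute (a r hr) (b r hr) := by
  ext1 <;> simp [a, b]

end GNGroup

end GroupDefinition

/-- The twist `J = (1/p) ∑_{u,v=0}^{p-1} ζ^{-uv} τ^u ⊗ σ^v` for the group algebra `K G`. -/
noncomputable def twistGN {p q : ℕ} [Fact p.Prime] (r : (ZMod q)ˣ) (hr : orderOf r = p)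
    {K : Type*} [Field K] [CharZero K] {ζ : K} (hζ : IsPrimitiveRoot ζ p) :
    HopfTwist K (MonoidAlgebra K (GNGroup r hr)) :=
  BicharacterTwist.twist hζ
    (t := MonoidAlgebra.of K _ (GNGroup.tau r hr)) (s := MonoidAlgebra.of K _ (GNGroup.sigma r hr))
    (by rw [← map_pow, GNGroup.tau_pow, map_one]) (by rw [← map_pow, GNGroup.sigma_pow, map_one])
    ((GNGroup.tau_commute_sigma r hr).map _)
    (MonoidAlgebra.isGroupLikeElem_of _) (MonoidAlgebra.isGroupLikeElem_of _)

/-- The Hopf algebra `B_{p,q}(ζ) = (K G)_J`. -/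
abbrev BHopf {p q : ℕ} [Fact p.Prime] (r : (ZMod q)ˣ) (hr : orderOf r = p)
    {K : Type*} [Field K] [CharZero K] {ζ : K} (hζ : IsPrimitiveRoot ζ p) : Type _ :=
  (twistGN r hr hζ).Twisted

/-- An order of a `K`-vector space `V` over a subring `R` of `K`: a finitely generated projective
`R`-submodule `X` of `V` such that the natural map `X ⊗_R K → V` is an isomorphism. -/
structure IsOrderIn {K V : Type*} [Field K] [AddCommGroup V] [Module K V] (R : Subring K)
    (X : Submodule R V) : Prop where
  finite : Module.Finite R X
  projective : Module.Projective R X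
  isBaseChange : IsBaseChange K X.subtype

/-- The image of `X ⊗_R X` in `H ⊗_K H`. -/
def tensorSquare {K H : Type*} [Field K] [AddCommGroup H] [Module K H] {R : Subring K}
    (X : Submodule R H) : Submodule R (H ⊗[K] H) :=
  Submodule.span R {z | ∃ x ∈ X, ∃ y ∈ X, x ⊗ₜ[K] y = z}

/-- A Hopf order of a Hopf algebra `H` over a subring `R` of the base field `K`. -/
structure IsHopfOrder {K H : Type*} [Field K] [Ring H] [HopfAlgebra K H] (R : Subring K)
    (X : Submodule R H) : Prop extends IsOrderIn R X where
  one_mem : (1 : H) ∈ X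
  mul_mem : ∀ x ∈ X, ∀ y ∈ X, x * y ∈ X
  comul_mem : ∀ x ∈ X, Coalgebra.comul (R := K) x ∈ tensorSquare X
  counit_mem : ∀ x ∈ X, Coalgebra.counit (R := K) x ∈ R
  antipode_mem : ∀ x ∈ X, HopfAlgebra.antipode K x ∈ X

/-- `H` admits a Hopf order over the subring `R` of its base field. -/
def AdmitsHopfOrder {K : Type*} [Field K] (R : Subring K) (H : Type*) [Ring H]
    [HopfAlgebra K H] : Prop :=
  ∃ X : Submodule R H, IsHopfOrder R X

/-- The ring of integers `𝓞_F` of a subfield `F` of `K`, as a subring of `K`. For a number field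
`K` these are the number rings contained in `K`. -/
def numberRing {K : Type*} [Field K] (F : Subfield K) : Subring K :=
  (F.subtype.comp (algebraMap (NumberField.RingOfIntegers F) F)).range

/-!
The idea is that a Hopf order `X` of `H` over `R` contains more than it seems: after enlarging `R`
to its integral closure in `K`, characters of `H` are integral on `X`
(`IsHopfOrder.isIntegral_trace`), and, dually, the trace of every comatrix of `H` lies in `X`
(`IsHopfOrder.sum_diag_mem`). Both hold because an element of `X`, respectively a functional that is
integral on `X`, is integral over `R`, so that the eigenvalues of its action are integral.

In `B_{p,q}(ζ)` let `e_i(τ)` and `e_i(σ)` be the spectral idempotents of `τ` and `σ`, so that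
`J = ∑ e_i(τ) ⊗ σ^i`. Conjugation by `J` turns the group-like elements `a^{c r^j}`, which `σ`
permutes, into the comatrix `(e_{k-j}(τ) a^{c r^j})_{j,k}`, and likewise for `b` with the roles of
`σ` and `τ` exchanged (`BicharacterTwist.twist_comul_left`, `BicharacterTwist.twist_comul_right`).
The traces `e_0(τ) ∑_j a^{c r^j}` and `e_0(σ) ∑_j b^{r^j}` thus lie in `X`, and so does the product
`w = (e_0(τ) ∑_j a^{-r^j}) (e_0(σ) ∑_j b^{r^j})`.

Let `Ψ` be the character of the action of `G` on `ℤ_q × ℤ_q` by affine maps in each factor. The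
functional `f(x) = Ψ(x w)` is integral on `X`, hence so is its convolution square. Counting fixed
points gives `f(e_{k-j}(τ) a^{r^j}) = δ_{j,k} m / p` with `m = (p - 1) (p (p - 1) + q)`, so the
convolution square of `f` takes the value `p (m / p)² = m² / p` at `e_0(τ) ∑_j a^{r^j} ∈ X`. Since
`p ∣ q - 1`, the integer `m` is prime to `p`, and `1/p` is integral over `R`
(`GNGroup.isIntegral_inv_of_isHopfOrder`).
-/

/-! ### Integrality of traces -/

/-- Over the algebraic closure the trace is the sum of the eigenvalues, and each eigenvalue is a
root of the monic polynomial that annihilates the matrix. -/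
theorem Matrix.isIntegral_trace_of_isIntegral {R K n : Type*} [CommRing R] [Field K] [Algebra R K]
    [Fintype n] [DecidableEq n] {M : Matrix n n K} (hM : IsIntegral R M) :
    IsIntegral R M.trace := by
  let L := AlgebraicClosure K
  let φ : K →ₐ[R] L := IsScalarTower.toAlgHom R K L
  have hφ : Function.Injective φ := (algebraMap K L).injective
  rw [← isIntegral_algHom_iff φ hφ]
  have hN : IsIntegral R (φ.mapMatrix M) := hM.map φ.mapMatrix
  have htr : φ M.trace = (φ.mapMatrix M).trace := by
    simp [Matrix.trace]
  rw [htr, Matrix.trace_eq_sum_roots_charpoly]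
  suffices h : ∀ x ∈ (φ.mapMatrix M).charpoly.roots, x ∈ integralClosure R L from
    multiset_sum_mem _ h
  intro x hx
  obtain ⟨P, hP, hPM⟩ := hN
  refine ⟨P, hP, ?_⟩
  rw [← Polynomial.eval_map]
  by_contra hne
  have hspec : x ∈ spectrum L (φ.mapMatrix M) :=
    Matrix.mem_spectrum_iff_isRoot_charpoly.mpr (Polynomial.isRoot_of_mem_roots hx)
  have h0 : Polynomial.aeval (φ.mapMatrix M) (P.map (algebraMap R L)) = 0 := by
    rw [Polynomial.aeval_map_algebraMap]
    exact hPM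
  have h1 := spectrum.subset_polynomial_aeval (φ.mapMatrix M) (P.map (algebraMap R L))
    ⟨x, hspec, rfl⟩
  rw [h0, spectrum.mem_iff, sub_zero] at h1
  exact h1 ((IsUnit.mk0 _ hne).map (algebraMap L _))

/-- An element of a finitely generated submodule closed under multiplication is integral. The
submodule need not contain `1`. -/
theorem IsIntegral.of_mem_fg_of_mul_mem {R A : Type*} [CommRing R] [Ring A] [Algebra R A]
    {N : Submodule R A} (hN : N.FG) (hmul : ∀ x ∈ N, ∀ y ∈ N, x * y ∈ N) {x : A} (hx : x ∈ N) :
    IsIntegral R x := by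
  let N' : Submodule R A := Submodule.span R {1} ⊔ N
  have hle : N ≤ N' := le_sup_right
  have h1 : (1 : A) ∈ N' := Submodule.mem_sup_left (Submodule.mem_span_singleton_self 1)
  have hmul' : ∀ x y : A, x ∈ N' → y ∈ N' → x * y ∈ N' := by
    intro x y hx hy
    obtain ⟨c, hc, n, hn, rfl⟩ := Submodule.mem_sup.mp hx
    obtain ⟨d, hd, m, hm, rfl⟩ := Submodule.mem_sup.mp hy
    obtain ⟨c, rfl⟩ := Submodule.mem_span_singleton.mp hc
    obtain ⟨d, rfl⟩ := Submodule.mem_span_singleton.mp hd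
    have : (c • (1 : A) + n) * (d • (1 : A) + m) =
        (c * d) • (1 : A) + (c • m + d • n + n * m) := by
      simp only [add_mul, mul_add, smul_mul_assoc, mul_smul_comm, one_mul, mul_one, smul_add,
        smul_smul, mul_comm d c]
      abel
    rw [this]
    exact Submodule.add_mem_sup (Submodule.smul_mem _ _ (Submodule.mem_span_singleton_self 1))
      (add_mem (add_mem (N.smul_mem c hm) (N.smul_mem d hn)) (hmul n hn m hm))
  exact IsIntegral.of_mem_of_fg (N'.toSubalgebra h1 hmul')
    ((Submodule.fg_span_singleton (1 : A)).sup hN) x (hle hx)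

/-! ### Integral extensions of Hopf orders -/

/-- A dual basis of a projective module, extended to the ambient vector space. -/
theorem IsOrderIn.exists_dualBasis {K V : Type*} [Field K] [AddCommGroup V] [Module K V]
    {R : Subring K} {X : Submodule R V} (hX : IsOrderIn R X) :
    ∃ (n : ℕ) (x : Fin n → V) (f : Fin n → V →ₗ[K] K), (∀ i, x i ∈ X) ∧
      (∀ i, ∀ v ∈ X, f i v ∈ R) ∧ ∀ v, v = ∑ i, f i v • x i := by
  have := hX.finite
  have := hX.projective
  obtain ⟨n, π, g, -, -, hπg⟩ := Module.Finite.exists_comp_eq_id_of_projective R X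
  let f (i : Fin n) : V →ₗ[K] K := hX.isBaseChange.lift
    (Algebra.linearMap R K ∘ₗ LinearMap.proj i ∘ₗ g)
  have hf (i : Fin n) (v : X) : f i v = (g v i : K) := hX.isBaseChange.lift_eq _ v
  refine ⟨n, fun i => π (Pi.single i 1), f, fun i => (π _).2, fun i v hv => ?_, fun v => ?_⟩
  · rw [hf i ⟨v, hv⟩]
    exact (g _ i).2
  · have hid : (LinearMap.id : V →ₗ[K] V) =
        ∑ i, (f i).smulRight (π (Pi.single i 1) : V) := by
      refine hX.isBaseChange.algHom_ext _ _ fun v => ?_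
      have h1 : π (g v) = v := LinearMap.congr_fun hπg v
      conv_lhs => rw [← h1, pi_eq_sum_univ' (g v)]
      simp [hf, Subring.smul_def]
    simpa using LinearMap.congr_fun hid v

namespace IsHopfOrder

variable {K H : Type*} [Field K] [Ring H] [HopfAlgebra K H] {R : Subring K} {X : Submodule R H}

variable (R) in
/-- The integral closure of `R` in `K`, as a subring of `K`. -/
abbrev intClosure : Subring K := (integralClosure R K).toSubring

theorem mem_intClosure {k : K} : k ∈ intClosure R ↔ IsIntegral R k := Iff.rfl

theorem le_intClosure : R ≤ intClosure R := fun k hk =>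
  mem_intClosure.mpr (isIntegral_algebraMap (x := (⟨k, hk⟩ : R)))

theorem mem_intClosure_of_isIntegral {k : K} (hk : IsIntegral (intClosure R) k) :
    k ∈ intClosure R :=
  isIntegral_trans (R := R) (A := integralClosure R K) k hk

variable (X) in
/-- The span of `X` over the integral closure of `R` in `K`: the extension of scalars of the
order. -/
abbrev intSpan : Submodule (intClosure R) H := Submodule.span (intClosure R) (X : Set H)

theorem apply_mem_of_mem_intSpan {V : Type*} [AddCommGroup V] [Module K V] {Y : Set V}
    {f : V →ₗ[K] K} (hf : ∀ v ∈ Y, f v ∈ intClosure R) {v : V}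
    (hv : v ∈ Submodule.span (intClosure R) Y) : f v ∈ intClosure R := by
  induction hv using Submodule.span_induction with
  | mem x hx => exact hf x hx
  | zero => simp
  | add x y _ _ hx hy => rw [map_add]; exact add_mem hx hy
  | smul c x _ hx => rw [Subring.smul_def, map_smul]; exact MulMemClass.mul_mem c.2 hx

theorem intSpan_fg (hX : IsHopfOrder R X) : (intSpan X).FG := by
  obtain ⟨n, x, f, hx, hf, hxf⟩ := hX.exists_dualBasis
  have h : intSpan X = Submodule.span (intClosure R) (Set.range x) := by
    refine le_antisymm (Submodule.span_le.mpr fun v hv => ?_) (Submodule.span_mono ?_)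
    · rw [SetLike.mem_coe, hxf v]
      refine sum_mem fun i _ => ?_
      exact Submodule.smul_mem _ (⟨f i v, le_intClosure (hf i v hv)⟩ : intClosure R)
        (Submodule.subset_span ⟨i, rfl⟩)
    · rintro _ ⟨i, rfl⟩
      exact hx i
  rw [h]
  exact Submodule.fg_span (Set.finite_range x)

theorem mul_mem_intSpan (hX : IsHopfOrder R X) {x y : H} (hx : x ∈ intSpan X)
    (hy : y ∈ intSpan X) : x * y ∈ intSpan X := by
  induction hx, hy using Submodule.span_induction₂ with
  | mem_mem x y hx hy => exact Submodule.subset_span (hX.mul_mem x hx y hy)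
  | zero_left => simp
  | zero_right => simp
  | add_left x y z _ _ _ h1 h2 => rw [add_mul]; exact add_mem h1 h2
  | add_right x y z _ _ _ h1 h2 => rw [mul_add]; exact add_mem h1 h2
  | smul_left c x y _ _ h => rw [smul_mul_assoc]; exact Submodule.smul_mem _ c h
  | smul_right c x y _ _ h => rw [mul_smul_comm]; exact Submodule.smul_mem _ c h

/-- Characters of `H` take integral values on a Hopf order. -/
theorem isIntegral_trace (hX : IsHopfOrder R X) {n : Type*} [Fintype n] [DecidableEq n]
    (ρ : H →ₐ[K] Matrix n n K) {x : H} (hx : x ∈ intSpan X) :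
    (ρ x).trace ∈ intClosure R := by
  have h : IsIntegral (intClosure R) x :=
    .of_mem_fg_of_mul_mem hX.intSpan_fg (fun _ hx _ hy => hX.mul_mem_intSpan hx hy) hx
  exact mem_intClosure_of_isIntegral (Matrix.isIntegral_trace_of_isIntegral (h.map ρ))

/-- If `f` and `g` are integral on a Hopf order then so is their convolution product. -/
theorem map_comul_mem (hX : IsHopfOrder R X) {f g : H →ₗ[K] K}
    (hf : ∀ v ∈ intSpan X, f v ∈ intClosure R) (hg : ∀ v ∈ intSpan X, g v ∈ intClosure R)
    {v : H} (hv : v ∈ intSpan X) :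
    LinearMap.mul' K K (TensorProduct.map f g (Coalgebra.comul (R := K) v)) ∈ intClosure R := by
  refine apply_mem_of_mem_intSpan
    (f := LinearMap.mul' K K ∘ₗ TensorProduct.map f g ∘ₗ Coalgebra.comul) (fun x hx => ?_) hv
  rw [LinearMap.comp_apply, LinearMap.comp_apply]
  have hz := hX.comul_mem x hx
  generalize Coalgebra.comul (R := K) x = z at hz
  induction hz using Submodule.span_induction with
  | mem z hz =>
    obtain ⟨x, hx, y, hy, rfl⟩ := hz
    simpa using MulMemClass.mul_mem (hf x (Submodule.subset_span hx)) (hg y (Submodule.subset_span hy))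
  | zero => simp
  | add x y _ _ hx hy => rw [map_add, map_add]; exact add_mem hx hy
  | smul c x _ hx =>
    rw [← algebraMap_smul K c x, map_smul, map_smul]
    exact MulMemClass.mul_mem (le_intClosure c.2) hx

/-- Characters of the dual algebra lie in (the integral extension of) a Hopf order: the trace of a
comatrix lies in `intSpan X`. A functional that is integral on `X` is integral in the dual algebra,
so its value at this trace, being the trace of its matrix, is integral. -/
theorem sum_diag_mem (hX : IsHopfOrder R X) {n : Type*} [Fintype n] [DecidableEq n]
    (E : n → n → H)
    (hE : ∀ i j, Coalgebra.comul (R := K) (E i j) = ∑ m, E i m ⊗ₜ[K] E m j) :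
    ∑ i, E i i ∈ intSpan X := by
  obtain ⟨d, x, f, hx, hf, hxf⟩ := hX.exists_dualBasis
  have hf' (i : Fin d) : ∀ v ∈ intSpan X, f i v ∈ intClosure R := fun v hv =>
    apply_mem_of_mem_intSpan (fun v hv => le_intClosure (hf i v hv)) hv
  let M (i : Fin d) : Matrix n n K := Matrix.of fun a b => f i (E a b)
  let N : Submodule (intClosure R) (Matrix n n K) := Submodule.span _ (Set.range M)
  have hMM (i j : Fin d) : M i * M j ∈ N := by
    have : M i * M j = ∑ k, LinearMap.mul' K K
        (TensorProduct.map (f i) (f j) (Coalgebra.comul (R := K) (x k))) • M k := by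
      ext a b
      have h : (M i * M j) a b = LinearMap.mul' K K
          (TensorProduct.map (f i) (f j) (Coalgebra.comul (R := K) (E a b))) := by
        simp [hE, M, Matrix.mul_apply]
      rw [h, hxf (E a b)]
      simp [Matrix.sum_apply, M, mul_comm]
    rw [this]
    refine sum_mem fun k _ => ?_
    exact Submodule.smul_mem _ (⟨_, hX.map_comul_mem (hf' i) (hf' j)
      (Submodule.subset_span (hx k))⟩ : intClosure R) (Submodule.subset_span ⟨k, rfl⟩)
  have hNN : ∀ y ∈ N, ∀ z ∈ N, y * z ∈ N := by
    intro y hy z hz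
    have : N * N ≤ N := by
      rw [Submodule.span_mul_span, Submodule.span_le]
      rintro _ ⟨_, ⟨i, rfl⟩, _, ⟨j, rfl⟩, rfl⟩
      exact hMM i j
    exact this (Submodule.mul_mem_mul hy hz)
  have htr (i : Fin d) : f i (∑ a, E a a) ∈ intClosure R := by
    have h : IsIntegral (intClosure R) (M i) :=
      .of_mem_fg_of_mul_mem (Submodule.fg_span (Set.finite_range M)) hNN
        (Submodule.subset_span ⟨i, rfl⟩)
    have h2 := mem_intClosure_of_isIntegral (Matrix.isIntegral_trace_of_isIntegral h)
    simpa [Matrix.trace, M] using h2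
  rw [hxf (∑ a, E a a)]
  refine sum_mem fun i _ => ?_
  exact Submodule.smul_mem _ (⟨_, htr i⟩ : intClosure R) (Submodule.subset_span (hx i))

end IsHopfOrder

/-! ### Comatrices in a bicharacter twist -/

/-- To compute `Δ_J(h) = J Δ(h) J⁻¹` it suffices to move `J` past `Δ(h)`. -/
theorem HopfTwist.comul_eq_of_mul_eq {K H : Type*} [CommRing K] [Ring H] [HopfAlgebra K H]
    (T : HopfTwist K H) {h : H} {z : H ⊗[K] H}
    (hz : (T.J : H ⊗[K] H) * Coalgebra.comul (R := K) h = z * (T.J : H ⊗[K] H)) :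
    T.comul h = z := by
  rw [T.comul_apply, hz, mul_assoc, T.J.mul_inv, mul_one]

namespace BicharacterTwist

variable {K H : Type*} [Field K] [Ring H] [HopfAlgebra K H] {p : ℕ} [Fact p.Prime]

theorem comul_idem (χ : AddChar (ZMod p) K) {t : H} (ht : IsGroupLikeElem K t) (v : ZMod p) :
    Coalgebra.comul (R := K) (idem χ t v) =
      (p : K)⁻¹ • ∑ u : ZMod p, χ (-(u * v)) • ((t ^ u.val) ⊗ₜ[K] (t ^ u.val)) := by
  simp only [idem, map_smul, map_sum, Bialgebra.comul_pow, ht.comul_eq_tmul_self,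
    Algebra.TensorProduct.tmul_pow]

theorem commute_idem (χ : AddChar (ZMod p) K) {t x : H} (h : Commute x t) (v : ZMod p) :
    Commute x (idem χ t v) :=
  Commute.smul_right (Commute.sum_right _ _ _ fun _ _ => (h.pow_right _).smul_right _) _

/-- `(f_i ⊗ 1) Δ(f_v) = f_i ⊗ f_{v-i}` for the idempotents `f_i` attached to a group-like
element. -/
theorem idem_tmul_mul_comul (χ : AddChar (ZMod p) K) {t : H} (htp : t ^ p = 1)
    (ht : IsGroupLikeElem K t) (i v : ZMod p) (x : H) :
    (idem χ t i ⊗ₜ[K] x) * Coalgebra.comul (R := K) (idem χ t v) =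
      idem χ t i ⊗ₜ[K] (x * idem χ t (v - i)) := by
  rw [comul_idem χ ht, mul_smul_comm, Finset.mul_sum]
  conv_rhs => rw [idem.eq_def χ t (v - i), mul_smul_comm, TensorProduct.tmul_smul,
    Finset.mul_sum, TensorProduct.tmul_sum]
  congr 1
  refine Finset.sum_congr rfl fun u _ => ?_
  rw [mul_smul_comm, Algebra.TensorProduct.tmul_mul_tmul, idem_mul_pow χ htp,
    ← TensorProduct.smul_tmul', smul_smul, ← AddChar.map_add_eq_mul, mul_smul_comm,
    TensorProduct.tmul_smul]
  congr 2
  ring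

/-- The mirror image of `idem_tmul_mul_comul`. -/
theorem tmul_idem_mul_comul (χ : AddChar (ZMod p) K) {s : H} (hsp : s ^ p = 1)
    (hs : IsGroupLikeElem K s) (i v : ZMod p) (x : H) :
    (x ⊗ₜ[K] idem χ s i) * Coalgebra.comul (R := K) (idem χ s v) =
      (x * idem χ s (v - i)) ⊗ₜ[K] idem χ s i := by
  rw [comul_idem χ hs, mul_smul_comm, Finset.mul_sum]
  conv_rhs => rw [idem.eq_def χ s (v - i), mul_smul_comm, ← TensorProduct.smul_tmul',
    Finset.mul_sum, TensorProduct.sum_tmul]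
  congr 1
  refine Finset.sum_congr rfl fun u _ => ?_
  rw [mul_smul_comm, Algebra.TensorProduct.tmul_mul_tmul, idem_mul_pow χ hsp,
    TensorProduct.tmul_smul, smul_smul, ← AddChar.map_add_eq_mul, mul_smul_comm,
    ← TensorProduct.smul_tmul']
  congr 2
  ring

/-- The twist `∑_i e_i(t) ⊗ s^i`, expanded along the idempotents of `s` instead of those of
`t`. -/
theorem sum_idem_tmul_pow (χ : AddChar (ZMod p) K) (t s : H) :
    ∑ i : ZMod p, idem χ t i ⊗ₜ[K] (s ^ i.val) = ∑ u : ZMod p, (t ^ u.val) ⊗ₜ[K] idem χ s u := by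
  simp only [idem, ← TensorProduct.smul_tmul', TensorProduct.tmul_smul, TensorProduct.sum_tmul,
    TensorProduct.tmul_sum]
  rw [← Finset.smul_sum, ← Finset.smul_sum, Finset.sum_comm]
  simp only [mul_comm]

variable [CharZero K] {ζ : K} (hζ : IsPrimitiveRoot ζ p) {t s : H}
  (htp : t ^ p = 1) (hsp : s ^ p = 1) (hts : Commute t s)
  (ht : IsGroupLikeElem K t) (hs : IsGroupLikeElem K s)

theorem twist_J_eq : ((twist hζ htp hsp hts ht hs).J : H ⊗[K] H) = ∑ i : ZMod p,
      idem (AddChar.zmodChar p hζ.pow_eq_one) t i ⊗ₜ[K] (s ^ i.val) :=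
  tensorSum_inv_eq hζ t s

/-- If `x_j` are group-like elements that commute with `t` and are permuted cyclically by
conjugation by `s`, then `(e_{k-j}(t) x_j)_{j,k}` is a comatrix for the twisted comultiplication. -/
theorem twist_comul_left {x : ZMod p → H} (hx : ∀ j, IsGroupLikeElem K (x j))
    (hxt : ∀ j, Commute (x j) t) (hxs : ∀ i j : ZMod p, s ^ i.val * x j = x (j + i) * s ^ i.val)
    (j k : ZMod p) :
    (twist hζ htp hsp hts ht hs).comul (idem (AddChar.zmodChar p hζ.pow_eq_one) t (k - j) * x j) =
      ∑ m : ZMod p, (idem (AddChar.zmodChar p hζ.pow_eq_one) t (m - j) * x j) ⊗ₜ[K]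
        (idem (AddChar.zmodChar p hζ.pow_eq_one) t (k - m) * x m) := by
  set χ := AddChar.zmodChar p hζ.pow_eq_one
  have hχ : χ.IsPrimitive := AddChar.zmodChar_primitive_of_primitive_root p hζ
  refine HopfTwist.comul_eq_of_mul_eq _ ?_
  rw [twist_J_eq, Bialgebra.comul_mul, (hx j).comul_eq_tmul_self, Finset.sum_mul, Finset.sum_mul]
  refine Fintype.sum_equiv (Equiv.addRight j) _ _ fun i => ?_
  rw [Finset.mul_sum, Finset.sum_eq_single i]
  · have h1 : s ^ i.val * idem χ t (k - j - i) = idem χ t (k - j - i) * s ^ i.val :=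
      commute_idem χ (hts.symm.pow_left _) _
    simp only [Equiv.coe_addRight, add_sub_cancel_right]
    rw [← mul_assoc, idem_tmul_mul_comul χ htp ht, Algebra.TensorProduct.tmul_mul_tmul,
      Algebra.TensorProduct.tmul_mul_tmul, h1, mul_assoc, mul_assoc, mul_assoc, hxs,
      (commute_idem χ (hxt j) i).eq, ← mul_assoc (idem χ t i), idem_mul_idem hχ htp, if_pos rfl,
      sub_sub, add_comm i j]
  · intro l _ hl
    simp only [Equiv.coe_addRight, add_sub_cancel_right]
    rw [Algebra.TensorProduct.tmul_mul_tmul, mul_assoc, (commute_idem χ (hxt j) l).eq,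
      ← mul_assoc, idem_mul_idem hχ htp, if_neg (Ne.symm hl), zero_mul, TensorProduct.zero_tmul]
  · simp

/-- The mirror image of `twist_comul_left`, with the roles of `t` and `s` exchanged. -/
theorem twist_comul_right {y : ZMod p → H} (hy : ∀ j, IsGroupLikeElem K (y j))
    (hys : ∀ j, Commute (y j) s) (hyt : ∀ i j : ZMod p, t ^ i.val * y j = y (j + i) * t ^ i.val)
    (k j : ZMod p) :
    (twist hζ htp hsp hts ht hs).comul (idem (AddChar.zmodChar p hζ.pow_eq_one) s (k - j) * y j) =
      ∑ m : ZMod p, (idem (AddChar.zmodChar p hζ.pow_eq_one) s (k - m) * y m) ⊗ₜ[K]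
        (idem (AddChar.zmodChar p hζ.pow_eq_one) s (m - j) * y j) := by
  set χ := AddChar.zmodChar p hζ.pow_eq_one
  have hχ : χ.IsPrimitive := AddChar.zmodChar_primitive_of_primitive_root p hζ
  refine HopfTwist.comul_eq_of_mul_eq _ ?_
  rw [twist_J_eq, sum_idem_tmul_pow, Bialgebra.comul_mul, (hy j).comul_eq_tmul_self,
    Finset.sum_mul, Finset.sum_mul]
  refine Fintype.sum_equiv (Equiv.addRight j) _ _ fun i => ?_
  rw [Finset.mul_sum, Finset.sum_eq_single i]
  · have h1 : t ^ i.val * idem χ s (k - j - i) = idem χ s (k - j - i) * t ^ i.val :=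
      commute_idem χ (hts.pow_left _) _
    simp only [Equiv.coe_addRight, add_sub_cancel_right]
    rw [← mul_assoc, tmul_idem_mul_comul χ hsp hs, Algebra.TensorProduct.tmul_mul_tmul,
      Algebra.TensorProduct.tmul_mul_tmul, h1, mul_assoc, mul_assoc, mul_assoc, hyt,
      (commute_idem χ (hys j) i).eq, ← mul_assoc (idem χ s i), idem_mul_idem hχ hsp, if_pos rfl,
      sub_sub, add_comm i j]
  · intro l _ hl
    simp only [Equiv.coe_addRight, add_sub_cancel_right]
    rw [Algebra.TensorProduct.tmul_mul_tmul, mul_assoc (idem χ s i), (commute_idem χ (hys j) l).eq,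
      ← mul_assoc (idem χ s i), idem_mul_idem hχ hsp, if_neg (Ne.symm hl), zero_mul,
      TensorProduct.tmul_zero]
  · simp

end BicharacterTwist

/-! ### A permutation character of the group -/

section AffineAction

variable {p q : ℕ} [Fact p.Prime] (r : (ZMod q)ˣ) (hr : orderOf r = p)

/-- The action of `ℤ_q ⋊ ℤ_p` on `ℤ_q` by affine maps: `(c, i)` acts as `x ↦ c + r^i x`. -/
def SemidirectFactor.affine (g : SemidirectFactor r hr) (x : ZMod q) : ZMod q :=
  Multiplicative.toAdd g.left + unitPowHom r hr g.right * x

theorem SemidirectFactor.affine_one (x : ZMod q) : affine r hr 1 x = x := by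
  simp [affine]

theorem SemidirectFactor.affine_mul (g h : SemidirectFactor r hr) (x : ZMod q) :
    affine r hr (g * h) x = affine r hr g (affine r hr h x) := by
  simp [affine, unitPowAction, Units.smul_def, mul_add, mul_assoc, add_assoc]

theorem unitPowAction_ofAdd (i : ZMod p) (c : ZMod q) :
    unitPowAction r hr (Multiplicative.ofAdd i) (Multiplicative.ofAdd c) =
      Multiplicative.ofAdd ((r : ZMod q) ^ i.val * c) := by
  simp [unitPowAction, unitPowHom, Units.smul_def]

theorem unitPowHom_injective : Function.Injective (unitPowHom r hr) := by
  rw [injective_iff_map_eq_one]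
  intro i hi
  have h : orderOf r ∣ (Multiplicative.toAdd i).val := orderOf_dvd_of_pow_eq_one hi
  rw [hr] at h
  have h0 := Nat.eq_zero_of_dvd_of_lt h (ZMod.val_lt _)
  exact (ZMod.val_eq_zero _).mp h0

open scoped Classical in
/-- An affine map of `ℤ_q` with linear part different from `1` has exactly one fixed point. -/
theorem SemidirectFactor.card_fixed [Fact q.Prime] (g : SemidirectFactor r hr) :
    (Finset.univ.filter fun x => affine r hr g x = x).card =
      if g.right = 1 then (if g.left = 1 then q else 0) else 1 := by
  by_cases hg : g.right = 1
  · by_cases hl : g.left = 1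
    · simp [affine, hg, hl, ZMod.card]
    · rw [if_pos hg, if_neg hl, Finset.card_eq_zero, Finset.filter_eq_empty_iff]
      intro x _ hx
      simp [affine, hg] at hx
      exact hl hx
  · rw [if_neg hg, Finset.card_eq_one]
    have hne : (1 : ZMod q) - unitPowHom r hr g.right ≠ 0 := by
      rw [sub_ne_zero]
      intro h
      exact hg (unitPowHom_injective r hr (by rw [map_one]; exact Units.ext h.symm))
    refine ⟨Multiplicative.toAdd g.left / (1 - unitPowHom r hr g.right), ?_⟩
    ext x
    rw [Finset.mem_filter_univ, Finset.mem_singleton, affine, eq_div_iff hne]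
    constructor <;> intro h <;> linear_combination -h

end AffineAction

namespace GNGroup

section

variable {p q : ℕ} [Fact p.Prime] (r : (ZMod q)ˣ) (hr : orderOf r = p)

theorem sigma_pow_val (i : ZMod p) :
    sigma r hr ^ i.val = (SemidirectProduct.inr (Multiplicative.ofAdd i), 1) := by
  ext1 <;> simp [sigma, ← map_pow, ← ofAdd_nsmul]

theorem tau_pow_val (i : ZMod p) :
    tau r hr ^ i.val = (1, SemidirectProduct.inr (Multiplicative.ofAdd i)) := by
  ext1 <;> simp [tau, ← map_pow, ← ofAdd_nsmul]

theorem inr_mul_inl_ofAdd (i : ZMod p) (c : ZMod q) :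
    (SemidirectProduct.inr (Multiplicative.ofAdd i) : SemidirectFactor r hr) *
        SemidirectProduct.inl (Multiplicative.ofAdd c) =
      SemidirectProduct.inl (Multiplicative.ofAdd ((r : ZMod q) ^ i.val * c)) *
        SemidirectProduct.inr (Multiplicative.ofAdd i) := by
  ext1
  · simp only [SemidirectProduct.mul_left, SemidirectProduct.left_inr, SemidirectProduct.right_inr,
      SemidirectProduct.left_inl, SemidirectProduct.right_inl, unitPowAction_ofAdd, map_one,
      one_mul, mul_one]
  · simp

end

variable {p q : ℕ} [Fact p.Prime] [Fact q.Prime] (r : (ZMod q)ˣ) (hr : orderOf r = p)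
  (K : Type*) [Field K]

open scoped Classical in
/-- The permutation representation of `K G` on the functions on `ℤ_q × ℤ_q`. -/
noncomputable def affineRep : MonoidAlgebra K (GNGroup r hr) →ₐ[K]
    Matrix (ZMod q × ZMod q) (ZMod q × ZMod q) K :=
  MonoidAlgebra.lift K _ _
    { toFun g := Matrix.of fun x y =>
        if (SemidirectFactor.affine r hr g.1 y.1, SemidirectFactor.affine r hr g.2 y.2) = x
          then 1 else 0
      map_one' := by
        ext x y
        simp [SemidirectFactor.affine_one, Matrix.one_apply, eq_comm]
      map_mul' g h := by
        ext x y
        simp [SemidirectFactor.affine_mul, Matrix.mul_apply] }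

/-- The character of `affineRep`. -/
noncomputable def affineChar : MonoidAlgebra K (GNGroup r hr) →ₗ[K] K :=
  Matrix.traceLinearMap _ K K ∘ₗ (affineRep r hr K).toLinearMap

/-- The number of fixed points of the affine map given by `g`, as an element of `K`. -/
noncomputable def affineFixed (g : SemidirectFactor r hr) : K :=
  if g.right = 1 then (if g.left = 1 then (q : K) else 0) else 1

theorem affineChar_of (g : GNGroup r hr) : affineChar r hr K (MonoidAlgebra.of K _ g) =
    affineFixed r hr K g.1 * affineFixed r hr K g.2 := by
  classical
  have h1 (g : SemidirectFactor r hr) :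
      affineFixed r hr K g =
        ∑ x : ZMod q, if SemidirectFactor.affine r hr g x = x then 1 else 0 := by
    rw [Finset.sum_boole, SemidirectFactor.card_fixed, affineFixed]
    push_cast
    rfl
  rw [h1, h1, Finset.sum_mul_sum, ← Finset.sum_product', Finset.univ_product_univ]
  simp only [affineChar, affineRep, LinearMap.comp_apply, AlgHom.toLinearMap_apply,
    MonoidAlgebra.lift_of, Matrix.traceLinearMap_apply, Matrix.trace, MonoidHom.coe_mk,
    OneHom.coe_mk, Matrix.diag_apply, Matrix.of_apply]
  refine Finset.sum_congr rfl fun x _ => ?_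
  simp only [Prod.ext_iff, ite_zero_mul_ite_zero, one_mul]

/-- The group-like element `a^c` of `K G`. -/
noncomputable abbrev aPow (c : ZMod q) : MonoidAlgebra K (GNGroup r hr) :=
  MonoidAlgebra.of K _ (SemidirectProduct.inl (Multiplicative.ofAdd c), 1)

/-- The group-like element `b^c` of `K G`. -/
noncomputable abbrev bPow (c : ZMod q) : MonoidAlgebra K (GNGroup r hr) :=
  MonoidAlgebra.of K _ (1, SemidirectProduct.inl (Multiplicative.ofAdd c))

/-- The image of `σ` in `K G`. -/
noncomputable abbrev sigmaK : MonoidAlgebra K (GNGroup r hr) := MonoidAlgebra.of K _ (sigma r hr)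

/-- The image of `τ` in `K G`. -/
noncomputable abbrev tauK : MonoidAlgebra K (GNGroup r hr) := MonoidAlgebra.of K _ (tau r hr)

theorem sigmaK_pow_mul_aPow (i : ZMod p) (c : ZMod q) :
    sigmaK r hr K ^ i.val * aPow r hr K c =
      aPow r hr K ((r : ZMod q) ^ i.val * c) * sigmaK r hr K ^ i.val := by
  rw [← map_pow, ← map_mul, ← map_mul, sigma_pow_val, Prod.mk_mul_mk, inr_mul_inl_ofAdd]
  simp

theorem tauK_pow_mul_bPow (i : ZMod p) (c : ZMod q) :
    tauK r hr K ^ i.val * bPow r hr K c =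
      bPow r hr K ((r : ZMod q) ^ i.val * c) * tauK r hr K ^ i.val := by
  rw [← map_pow, ← map_mul, ← map_mul, tau_pow_val, Prod.mk_mul_mk, inr_mul_inl_ofAdd]
  simp

include hr in
theorem unit_pow_val_add (i j : ZMod p) :
    (r : ZMod q) ^ (i + j).val = (r : ZMod q) ^ i.val * (r : ZMod q) ^ j.val := by
  have h : (r : ZMod q) ^ p = 1 := by
    rw [← Units.val_pow_eq_pow_val, ← hr, pow_orderOf_eq_one, Units.val_one]
  rw [ZMod.val_add, ← pow_add, ← pow_eq_pow_mod _ h]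

include hr in
theorem unit_pow_val_injective :
    Function.Injective fun i : ZMod p => (r : ZMod q) ^ i.val := by
  intro i j h
  have := @unitPowHom_injective p q _ r hr (Multiplicative.ofAdd i) (Multiplicative.ofAdd j)
    (Units.ext (by simpa [unitPowHom] using h))
  simpa using this

/-- The two sums are over the elements `a^c σ^v` and `τ^u b^d`: those with `v ≠ 0` or `u ≠ 0` fix
one point of `ℤ_q`, and `b^d` fixes none. -/
theorem affineChar_idem_mul (χ : AddChar (ZMod p) K) (c d : ZMod q) (hd : d ≠ 0) :
    affineChar r hr K (BicharacterTwist.idem χ (tauK r hr K) 0 * aPow r hr K c *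
        (BicharacterTwist.idem χ (sigmaK r hr K) 0 * bPow r hr K d)) =
      ((p : K)⁻¹ * (p - 1 + if c = 0 then (q : K) else 0)) * ((p : K)⁻¹ * (p - 1)) := by
  have hprod (u v : ZMod p) : tauK r hr K ^ u.val * aPow r hr K c *
      (sigmaK r hr K ^ v.val * bPow r hr K d) = MonoidAlgebra.of K _
        ((SemidirectProduct.inl (Multiplicative.ofAdd c) *
            SemidirectProduct.inr (Multiplicative.ofAdd v),
          SemidirectProduct.inr (Multiplicative.ofAdd u) *
            SemidirectProduct.inl (Multiplicative.ofAdd d)) : GNGroup r hr) := by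
    rw [← map_pow, ← map_pow, ← map_mul, ← map_mul, ← map_mul, sigma_pow_val, tau_pow_val]
    simp
  have hsum (e : K) : ∑ v : ZMod p, (if v = 0 then e else 1) = p - 1 + e := by
    rw [← Finset.add_sum_erase _ _ (Finset.mem_univ (0 : ZMod p)), if_pos rfl,
      Finset.sum_congr rfl fun v hv => if_neg (Finset.ne_of_mem_erase hv)]
    simp [Finset.card_erase_of_mem, ZMod.card, Nat.cast_sub (Fact.out : p.Prime).one_le]
    ring
  have hu : ∑ u : ZMod p, affineFixed r hr K
      (SemidirectProduct.inr (Multiplicative.ofAdd u) *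
        SemidirectProduct.inl (Multiplicative.ofAdd d)) = p - 1 := by
    rw [← add_zero ((p : K) - 1), ← hsum]
    refine Finset.sum_congr rfl fun u _ => ?_
    simp [affineFixed, unitPowAction_ofAdd, hd]
  have hv : ∑ v : ZMod p, affineFixed r hr K
      (SemidirectProduct.inl (Multiplicative.ofAdd c) *
        SemidirectProduct.inr (Multiplicative.ofAdd v)) = p - 1 + if c = 0 then (q : K) else 0 := by
    rw [← hsum]
    refine Finset.sum_congr rfl fun u _ => ?_
    simp [affineFixed]
  simp only [BicharacterTwist.idem, mul_zero, neg_zero, AddChar.map_zero_eq_one, one_smul,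
    smul_mul_assoc, mul_smul_comm, Finset.sum_mul, Finset.mul_sum, map_smul, map_sum, hprod,
    affineChar_of]
  rw [← hv, ← hu]
  simp only [smul_eq_mul, ← Finset.mul_sum, ← Finset.sum_mul]
  ring

end GNGroup

/-! ### Denominators forced by a Hopf order -/

namespace GNGroup

open BicharacterTwist

variable {p q : ℕ} [Fact p.Prime] [Fact q.Prime] (r : (ZMod q)ˣ) (hr : orderOf r = p)
  {K : Type*} [Field K] [CharZero K] {ζ : K} (hζ : IsPrimitiveRoot ζ p)

/-- The idempotent `e_i(τ)`, the projection onto the `ζ^i`-eigenspace of `τ`. -/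
noncomputable abbrev idemTau (i : ZMod p) : MonoidAlgebra K (GNGroup r hr) :=
  idem (AddChar.zmodChar p hζ.pow_eq_one) (tauK r hr K) i

/-- The idempotent `e_i(σ)`, the projection onto the `ζ^i`-eigenspace of `σ`. -/
noncomputable abbrev idemSigma (i : ZMod p) : MonoidAlgebra K (GNGroup r hr) :=
  idem (AddChar.zmodChar p hζ.pow_eq_one) (sigmaK r hr K) i

/-- The comatrix entries `e_{k-j}(τ) a^{c r^j}`. -/
noncomputable def comatrixA (c : ZMod q) (j k : ZMod p) : MonoidAlgebra K (GNGroup r hr) :=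
  idemTau r hr hζ (k - j) * aPow r hr K (r ^ j.val * c)

/-- The comatrix entries `e_{k-j}(σ) b^{r^j}`. -/
noncomputable def comatrixB (k j : ZMod p) : MonoidAlgebra K (GNGroup r hr) :=
  idemSigma r hr hζ (k - j) * bPow r hr K (r ^ j.val)

theorem comul_comatrixA (c : ZMod q) (j k : ZMod p) :
    (twistGN r hr hζ).comul (comatrixA r hr hζ c j k) =
      ∑ m, comatrixA r hr hζ c j m ⊗ₜ[K] comatrixA r hr hζ c m k := by
  refine twist_comul_left hζ _ _ _ _ _ (x := fun j : ZMod p => aPow r hr K (r ^ j.val * c))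
    (fun j => MonoidAlgebra.isGroupLikeElem_of _) (fun j => Commute.map ?_ _) (fun i j => ?_) j k
  · ext1 <;> simp [tau]
  · rw [sigmaK_pow_mul_aPow, ← mul_assoc, add_comm j i, unit_pow_val_add r hr]

theorem comul_comatrixB (k j : ZMod p) :
    (twistGN r hr hζ).comul (comatrixB r hr hζ k j) =
      ∑ m, comatrixB r hr hζ k m ⊗ₜ[K] comatrixB r hr hζ m j := by
  refine twist_comul_right hζ _ _ _ _ _ (y := fun j : ZMod p => bPow r hr K (r ^ j.val))
    (fun j => MonoidAlgebra.isGroupLikeElem_of _) (fun j => Commute.map ?_ _) (fun i j => ?_) k j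
  · ext1 <;> simp [sigma]
  · rw [tauK_pow_mul_bPow, add_comm j i, unit_pow_val_add r hr]

/-- The product `(e_0(τ) ∑_i a^{-r^i}) (e_0(σ) ∑_l b^{r^l})` of the traces of the comatrices of
`a⁻¹` and `b`. -/
noncomputable def cocharProd : MonoidAlgebra K (GNGroup r hr) :=
  (∑ i, comatrixA r hr hζ (-1) i i) * ∑ l, comatrixB r hr hζ l l

/-- Multiplication by `cocharProd` kills the off-diagonal part of the comatrix because
`e_{k-j}(τ) e_0(τ) = 0` for `j ≠ k`. On the diagonal the projections `e_0(τ)` and `e_0(σ)` contribute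
a denominator `p²`. Summing the value of `affineChar_idem_mul` over the exponents of `b` cancels one
factor `p`; the sum over the exponents of `a` does not cancel the other, since `a^{r^j} a^{-r^i}`
is trivial for `i = j` only. -/
theorem affineChar_comatrixA_mul (j k : ZMod p) :
    affineChar r hr K (comatrixA r hr hζ 1 j k * cocharProd r hr hζ) =
      if j = k then (p : K)⁻¹ * ((p - 1) * (p * (p - 1) + q)) else 0 := by
  have hp : (p : K) ≠ 0 := Nat.cast_ne_zero.mpr (Fact.out : p.Prime).ne_zero
  have hχ := AddChar.zmodChar_primitive_of_primitive_root p hζ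
  have hterm (i l : ZMod p) : comatrixA r hr hζ 1 j k *
      (comatrixA r hr hζ (-1) i i * comatrixB r hr hζ l l) =
      if j = k then idemTau r hr hζ 0 * aPow r hr K ((r : ZMod q) ^ j.val - (r : ZMod q) ^ i.val) *
        (idemSigma r hr hζ 0 * bPow r hr K (r ^ l.val)) else 0 := by
    have hcomm (c : ZMod q) : Commute (aPow r hr K c) (idemTau r hr hζ 0) := by
      refine commute_idem _ (Commute.map ?_ _) _
      ext1 <;> simp [tau]
    have hidem : idemTau r hr hζ (k - j) * idemTau r hr hζ 0 =
        if j = k then idemTau r hr hζ 0 else 0 := by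
      rw [idem_mul_idem hχ (by rw [← map_pow, tau_pow, map_one])]
      simp only [sub_eq_zero, eq_comm]
    have ha (c d : ZMod q) : aPow r hr K c * aPow r hr K d = aPow r hr K (c + d) := by
      rw [← map_mul]
      congr 1
      simp [← map_mul]
    simp only [comatrixA, comatrixB, sub_self, mul_one]
    rw [← mul_assoc, mul_assoc (idemTau r hr hζ (k - j)), ← mul_assoc (aPow r hr K _), (hcomm _).eq,
      mul_assoc (idemTau r hr hζ 0), ← mul_assoc (idemTau r hr hζ (k - j)), hidem, ha]
    split_ifs
    · rw [mul_neg_one, sub_eq_add_neg]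
    · rw [zero_mul, zero_mul]
  rw [cocharProd, Finset.sum_mul_sum, Finset.mul_sum, map_sum]
  simp only [Finset.mul_sum, map_sum, hterm]
  split_ifs with hjk
  · have hne (l : ZMod p) : (r : ZMod q) ^ l.val ≠ 0 := pow_ne_zero _ r.ne_zero
    have hinj (i : ZMod p) : (r : ZMod q) ^ j.val - (r : ZMod q) ^ i.val = 0 ↔ j = i :=
      sub_eq_zero.trans (unit_pow_val_injective r hr).eq_iff
    simp only [affineChar_idem_mul _ _ _ _ _ _ (hne _), hinj]
    simp only [Finset.sum_const, Finset.card_univ, ZMod.card, nsmul_eq_mul, ← Finset.mul_sum,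
      ← Finset.sum_mul, Finset.sum_add_distrib, Finset.sum_ite_eq, Finset.mem_univ, if_true]
    field_simp
  · simp

variable {r hr hζ} in
/-- A Hopf order of `B_{p,q}(ζ)` over `R` forces `1/p` to be integral over `R`: the convolution
square of the functional `x ↦ affineChar (x * cocharProd)` is integral on the order, and it takes
the value `m²/p`, with `m` prime to `p`, at the trace of the comatrix of `a`. -/
theorem isIntegral_inv_of_isHopfOrder (hpq : p ∣ q - 1) {R : Subring K}
    {X : Submodule R (BHopf r hr hζ)} (hX : IsHopfOrder R X) : IsIntegral R (1 / (p : K)) := by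
  have hprime : p.Prime := Fact.out
  have hp : (p : K) ≠ 0 := Nat.cast_ne_zero.mpr hprime.ne_zero
  have hA (c : ZMod q) := hX.sum_diag_mem (n := ZMod p) (comatrixA r hr hζ c)
    (comul_comatrixA r hr hζ c)
  have hB := hX.sum_diag_mem (n := ZMod p) (comatrixB r hr hζ) (comul_comatrixB r hr hζ)
  have hW : (cocharProd r hr hζ : BHopf r hr hζ) ∈ IsHopfOrder.intSpan X :=
    hX.mul_mem_intSpan (hA (-1)) hB
  let ρ : BHopf r hr hζ →ₐ[K] Matrix (ZMod q × ZMod q) (ZMod q × ZMod q) K := affineRep r hr K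
  let f : BHopf r hr hζ →ₗ[K] K := affineChar r hr K ∘ₗ LinearMap.mulRight K (cocharProd r hr hζ)
  have hf : ∀ v ∈ IsHopfOrder.intSpan X, f v ∈ IsHopfOrder.intClosure R := fun v hv => by
    classical
    exact hX.isIntegral_trace ρ (hX.mul_mem_intSpan hv hW)
  let E : ZMod p → ZMod p → BHopf r hr hζ := comatrixA r hr hζ 1
  have hE (j k : ZMod p) : Coalgebra.comul (R := K) (E j k) = ∑ m, E j m ⊗ₜ[K] E m k :=
    comul_comatrixA r hr hζ 1 j k
  have hEX : ∑ j, E j j ∈ IsHopfOrder.intSpan X := hA 1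
  have hfE (j k : ZMod p) : f (E j k) =
      if j = k then (p : K)⁻¹ * ((p - 1) * (p * (p - 1) + q)) else 0 :=
    affineChar_comatrixA_mul r hr hζ j k
  clear_value E
  have hT := hX.map_comul_mem hf hf hEX
  have hval : LinearMap.mul' K K (TensorProduct.map f f
      (Coalgebra.comul (R := K) (∑ j, E j j))) =
      (((p - 1) * (p * (p - 1) + q) : ℤ) : K) ^ 2 / p := by
    simp only [map_sum, hE, TensorProduct.map_tmul, LinearMap.mul'_apply, hfE]
    have hdiag (c : K) (j k : ZMod p) :
        (if j = k then c else 0) * (if k = j then c else 0) = if j = k then c * c else 0 := by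
      by_cases h : j = k
      · simp [h]
      · simp [h]
    simp only [hdiag, Finset.sum_ite_eq, Finset.mem_univ, if_true,
      Finset.sum_const, Finset.card_univ, ZMod.card, nsmul_eq_mul]
    push_cast
    field_simp
  rw [hval] at hT
  -- `m = (p - 1) (p (p - 1) + q)` is prime to `p`, so `u m² + v p = 1` and `1/p = u m²/p + v`
  have hcop : IsCoprime (((p - 1) * (p * (p - 1) + q) : ℤ) ^ 2) (p : ℤ) := by
    have hpz : Prime (p : ℤ) := Nat.prime_iff_prime_int.mp hprime
    refine ((Irreducible.coprime_iff_not_dvd hpz.irreducible).mpr fun h => ?_).symm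
    have h1q : (p : ℤ) ∣ q - 1 := by
      have := Int.natCast_dvd_natCast.mpr hpq
      rwa [Nat.cast_sub (Fact.out : q.Prime).one_le, Nat.cast_one] at this
    refine hpz.not_isUnit (isUnit_of_dvd_one ?_)
    rcases hpz.dvd_or_dvd (hpz.dvd_of_dvd_pow h) with h | h
    · simpa using dvd_sub (dvd_refl (p : ℤ)) h
    · have h2 := dvd_sub (dvd_sub h (dvd_mul_right (p : ℤ) (p - 1))) h1q
      simpa using h2
  obtain ⟨u, v, huv⟩ := hcop
  have huvK : (u : K) * (((p - 1) * (p * (p - 1) + q) : ℤ) : K) ^ 2 + v * p = 1 := by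
    exact_mod_cast congrArg (Int.cast : ℤ → K) huv
  have heq : 1 / (p : K) = u * ((((p - 1) * (p * (p - 1) + q) : ℤ) : K) ^ 2 / p) + v := by
    rw [← huvK]
    field_simp
  rw [heq]
  exact (IsHopfOrder.intClosure R).add_mem
    ((IsHopfOrder.intClosure R).mul_mem (intCast_mem _ u) hT) (intCast_mem _ v)

end GNGroup

/-! ### Dedekind domains and number rings in a number field -/

theorem mainTheorem1 {p q : ℕ} [Fact p.Prime] [Fact q.Prime] (hpq : p ∣ q - 1)
    (r : (ZMod q)ˣ) (hr : orderOf r = p)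
    {K : Type*} [Field K] [NumberField K] {ζ : K} (hζ : IsPrimitiveRoot ζ p) :
    (∀ R : Subring K, IsDedekindDomain R →
        (algebraMap (NumberField.RingOfIntegers K) K).range ≤ R →
        AdmitsHopfOrder R (BHopf r hr hζ) → 1 / (p : K) ∈ R) ∧
      ∀ F : Subfield K, ¬ AdmitsHopfOrder (numberRing F) (BHopf r hr hζ) := by
  have hprime : p.Prime := Fact.out
  refine ⟨fun R hR hKR ⟨X, hX⟩ => ?_, fun F ⟨X, hX⟩ => ?_⟩
  · have hint := GNGroup.isIntegral_inv_of_isHopfOrder hpq hX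
    -- `R` contains `𝓞 K`, so `K` is its fraction field and integral elements of `K` lie in `R`
    have : IsFractionRing R K := by
      refine IsFractionRing.of_field R K fun z => ?_
      obtain ⟨x, y, -, rfl⟩ := IsFractionRing.div_surjective (A := NumberField.RingOfIntegers K) z
      exact ⟨⟨_, hKR ⟨x, rfl⟩⟩, ⟨_, hKR ⟨y, rfl⟩⟩, rfl⟩
    obtain ⟨y, hy⟩ := IsIntegrallyClosed.isIntegral_iff.mp hint
    rw [← hy]
    exact y.2
  · have hint := GNGroup.isIntegral_inv_of_isHopfOrder hpq hX
    have : Algebra.IsIntegral ℤ (numberRing F) := by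
      refine ⟨fun ⟨_, y, rfl⟩ => ?_⟩
      rw [← isIntegral_algHom_iff ((numberRing F).subtype.toIntAlgHom) Subtype.val_injective]
      exact (NumberField.RingOfIntegers.isIntegral_coe y).map (F.subtype.toIntAlgHom)
    have hint' : IsIntegral ℤ (1 / (p : ℚ)) := by
      have h : IsIntegral ℤ (1 / (p : K)) := isIntegral_trans (A := numberRing F) _ hint
      rw [← isIntegral_algHom_iff (algebraMap ℚ K).toIntAlgHom (algebraMap ℚ K).injective]
      simpa using h
    obtain ⟨z, hz⟩ := IsIntegrallyClosed.isIntegral_iff.mp hint'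
    have hpQ : (p : ℚ) ≠ 0 := Nat.cast_ne_zero.mpr hprime.ne_zero
    have h1 : z * (p : ℤ) = 1 := by
      rw [eq_div_iff hpQ, eq_intCast] at hz
      exact_mod_cast hz
    have := Int.isUnit_iff.mp (IsUnit.of_mul_eq_one_right _ h1)
    have := hprime.two_le
    omega
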